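/- A twisted action $(G,\alpha,\omega,A)$ consists of a (Hausdorff) locally compact group $G$ with identity $e$, a $C^*$-algebra $A$, a map $\alpha:G\to\mathrm{Aut}(A)$ such that $x\mapsto\alpha_x(a)$ is continuous for every $a\in A$, and a strictly continuous map $\omega$ from $G\times G$ to the unitary group of the multiplier algebra of $A$, such that for all $x,y,z\in G$ and $a\in A$ $$\alpha_x(\omega(y,z))\,\omega(x,yz)=\omega(x,y)\,\omega(xy,z),\qquad \alpha_x(\alpha_y(a))\,\omega(x,y)=\omega(x,y)\,\alpha_{xy}(a),$$ $$\omega(x,e)=\omega(e,y)=1,\qquad \alpha_e=\mathrm{id}_A.$$ Let $L^1_{\alpha,\omega}(G,A)$ be the Banach algebra of (classes of) Bochner integrable functions $\Phi:G\to A$ with respect to a left Haar measure, with the $L^1$-norm and the product $$(\Phi*\Psi)(x)=\int_G\Phi(y)\,\alpha_y[\Psi(y^{-1}x)]\,\omega(y,y^{-1}x)\,dy .$$ For an open subgroup $H\subset G$, regard $L^1_{\alpha,\omega}(H,A)$ as the subalgebra of $L^1_{\alpha,\omega}(G,A)$ of functions vanishing almost everywhere outside $H$. For a Banach algebra $B$,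 a Banach $B$-bimodule is a Banach space that is a $B$-bimodule with jointly continuous left and right actions. A linear map $\theta:X_1\to X_2$ between Banach $B$-bimodules, not assumed continuous, is a $B$-intertwining operator if for each $b\in B$ the maps $\xi\mapsto\theta(b\xi)-b\theta(\xi)$ and $\xi\mapsto\theta(\xi b)-\theta(\xi)b$ are continuous. Its separating space is $$\mathscr S(\theta)=\{\eta\in X_2 : \text{there are } \xi_n\in X_1 \text{ with } \xi_n\to0 \text{ and } \theta(\xi_n)\to\eta\},$$ and its continuity ideal is $\mathscr I(\theta)=\{b\in B: b\,\mathscr S(\theta)=\mathscr S(\theta)\,b=\{0\}\}$. **Proposition.** Let $(G,\alpha,\omega,A)$ be a twisted action, let $B=L^1_{\alpha,\omega}(G,A)$, let $X_1,X_2$ be Banach $B$-bimodules, and let $\theta:X_1\to X_2$ be a $B$-intertwining operator. Suppose that for every open, compactly generated subgroup $H\subset G$ the space $\mathscr I(\theta)\cap L^1_{\alpha,\omega}(H,A)$ has finite codimension in $L^1_{\alpha,\omega}(H,A)$. Then $\mathscr I(\theta)$ has finite codimension in $B$. -/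

import Mathlib

open MeasureTheory Filter Topology
open scoped MultiplierAlgebra

noncomputable section

/-! ### Twisted actions -/

section TwistedActions

variable {A : Type*} [NonUnitalCStarAlgebra A]

/-- A `*`-automorphism of a C*-algebra as a bounded linear map. -/
def StarAlgEquiv.toBounded (φ : A ≃⋆ₐ[ℂ] A) : A →L[ℂ] A where
  toFun := φ
  map_add' := map_add φ
  map_smul' := map_smul φ
  cont := (NonUnitalStarAlgHom.isometry φ (EquivLike.injective φ)).continuous

/-- The canonical extension of a `*`-automorphism `φ` of `A` to the multiplier algebra, which is
determined by `φ(u) a = φ(u φ⁻¹(a))` and `a φ(u) = φ(φ⁻¹(a) u)`. -/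
def StarAlgEquiv.extendMultiplier (φ : A ≃⋆ₐ[ℂ] A) (u : 𝓜(ℂ, A)) : 𝓜(ℂ, A) where
  fst := φ.toBounded ∘L u.fst ∘L φ.symm.toBounded
  snd := φ.toBounded ∘L u.snd ∘L φ.symm.toBounded
  central x y := by
    have h := congrArg φ (u.central (φ.symm x) (φ.symm y))
    simpa [StarAlgEquiv.toBounded] using h

/-- The element `a u ∈ A`, for `a ∈ A` and a multiplier `u` of `A`. -/
def mulMultiplier (a : A) (u : 𝓜(ℂ, A)) : A := u.snd a

/-- `mulMultiplier a u` is the product of `a` and `u` in the multiplier algebra. -/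
theorem coe_mulMultiplier (a : A) (u : 𝓜(ℂ, A)) :
    ((mulMultiplier a u : A) : 𝓜(ℂ, A)) = (a : 𝓜(ℂ, A)) * u := by
  refine DoubleCentralizer.ext ℂ A _ _ (Prod.ext ?_ ?_)
  · ext b
    simp [mulMultiplier, u.central]
  · ext b
    have key : ∀ c, u.snd (b * a) * c = b * u.snd a * c := fun c => by
      rw [u.central, mul_assoc, mul_assoc, u.central]
    have h : u.snd (b * a) - b * u.snd a = 0 := by
      apply CStarRing.mul_star_self_eq_zero_iff _ |>.1
      rw [sub_mul, key, sub_self]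
    simpa [mulMultiplier] using (sub_eq_zero.1 h).symm

/-- A twisted action `(G, α, ω, A)` of a topological group `G` on a C*-algebra `A`: a strongly
continuous family of `*`-automorphisms `α x` of `A` and a strictly continuous family of unitary
multipliers `ω x y` of `A`, subject to the twisted cocycle identities. -/
structure TwistedAction (G : Type*) [Group G] [TopologicalSpace G]
    (A : Type*) [NonUnitalCStarAlgebra A] where
  α : G → (A ≃⋆ₐ[ℂ] A)
  ω : G → G → unitary 𝓜(ℂ, A)
  continuous_α : ∀ a : A, Continuous fun x => α x a
  continuous_ω_left : ∀ a : A, Continuous fun p : G × G => (ω p.1 p.2 : 𝓜(ℂ, A)).fst a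
  continuous_ω_right : ∀ a : A, Continuous fun p : G × G => (ω p.1 p.2 : 𝓜(ℂ, A)).snd a
  cocycle : ∀ x y z : G,
    (α x).extendMultiplier (ω y z : 𝓜(ℂ, A)) * (ω x (y * z) : 𝓜(ℂ, A)) =
      (ω x y : 𝓜(ℂ, A)) * (ω (x * y) z : 𝓜(ℂ, A))
  twist : ∀ (x y : G) (a : A),
    ((α x (α y a) : A) : 𝓜(ℂ, A)) * (ω x y : 𝓜(ℂ, A)) =
      (ω x y : 𝓜(ℂ, A)) * ((α (x * y) a : A) : 𝓜(ℂ, A))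
  ω_one_right : ∀ x : G, ω x 1 = 1
  ω_one_left : ∀ y : G, ω 1 y = 1
  α_one : ∀ a : A, α 1 a = a

end TwistedActions

/-! ### The twisted convolution algebra -/

section TwistedConvolution

variable {G : Type*} [Group G] [TopologicalSpace G] [MeasurableSpace G]
  {A : Type*} [NonUnitalCStarAlgebra A]

/-- The twisted convolution
`(Φ * Ψ)(x) = ∫ Φ(y) α_y(Ψ(y⁻¹x)) ω(y, y⁻¹x) dy` of two functions. -/
def TwistedAction.conv (T : TwistedAction G A) (μ : Measure G) (Φ Ψ : G → A) (x : G) : A :=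
  ∫ y, Φ y * mulMultiplier (T.α y (Ψ (y⁻¹ * x))) (T.ω y (y⁻¹ * x) : 𝓜(ℂ, A)) ∂μ

/-- The Banach space `L¹_{α,ω}(G, A)` of (classes of) Bochner integrable functions `G → A`. -/
def TwistedL1 (_T : TwistedAction G A) (μ : Measure G) : Type _ := Lp A 1 μ

variable (T : TwistedAction G A) (μ : Measure G)

instance : NormedAddCommGroup (TwistedL1 T μ) := inferInstanceAs (NormedAddCommGroup (Lp A 1 μ))

instance : NormedSpace ℂ (TwistedL1 T μ) := inferInstanceAs (NormedSpace ℂ (Lp A 1 μ))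

instance : CompleteSpace (TwistedL1 T μ) := inferInstanceAs (CompleteSpace (Lp A 1 μ))

/-- A representative of an element of `L¹_{α,ω}(G, A)`. -/
def TwistedL1.rep {T : TwistedAction G A} {μ : Measure G} (Φ : TwistedL1 T μ) : G → A :=
  ((show Lp A 1 μ from Φ : Lp A 1 μ) : G → A)

open Classical in
/-- The product of `L¹_{α,ω}(G, A)` is the class of the twisted convolution. (When `μ` is a Haar
measure of a locally compact group, the twisted convolution of two integrable functions is
integrable, so that the second branch does not occur.) -/
instance : Mul (TwistedL1 T μ) where
  mul Φ Ψ := if h : Integrable (T.conv μ Φ.rep Ψ.rep) μ then h.toL1 _ else (0 : Lp A 1 μ)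

/-- `L¹_{α,ω}(H, A)` inside `L¹_{α,ω}(G, A)`, for an open subgroup `H` of `G`: the functions that
vanish almost everywhere outside of `H`. (The Haar measure of an open subgroup is the restriction
of that of `G`, and functions on `H` are extended by zero.) -/
def TwistedL1.ofSubgroup (H : Subgroup G) : Submodule ℂ (TwistedL1 T μ) where
  carrier := {Φ | ∀ᵐ x ∂μ, x ∉ H → Φ.rep x = 0}
  zero_mem' := by
    have h : (TwistedL1.rep (0 : TwistedL1 T μ)) =ᵐ[μ] 0 := Lp.coeFn_zero A 1 μ
    filter_upwards [h] with x hx _ using hx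
  add_mem' {Φ Ψ} hΦ hΨ := by
    have h : (Φ + Ψ).rep =ᵐ[μ] Φ.rep + Ψ.rep :=
      Lp.coeFn_add (show Lp A 1 μ from Φ) (show Lp A 1 μ from Ψ)
    change ∀ᵐ x ∂μ, x ∉ H → (Φ + Ψ).rep x = 0
    filter_upwards [h, hΦ, hΨ] with x hx h1 h2 hxH
    rw [hx, Pi.add_apply, h1 hxH, h2 hxH, add_zero]
  smul_mem' c Φ hΦ := by
    have h : (c • Φ).rep =ᵐ[μ] c • Φ.rep := Lp.coeFn_smul c (show Lp A 1 μ from Φ)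
    change ∀ᵐ x ∂μ, x ∉ H → (c • Φ).rep x = 0
    filter_upwards [h, hΦ] with x hx h1 hxH
    rw [hx, Pi.smul_apply, h1 hxH, smul_zero]

end TwistedConvolution

/-- A subgroup of a topological group is compactly generated if it is generated, as a group, by a
compact subset. -/
def Subgroup.IsCompactlyGenerated {G : Type*} [Group G] [TopologicalSpace G]
    (H : Subgroup G) : Prop :=
  ∃ K : Set G, IsCompact K ∧ Subgroup.closure K = H

/-! ### Banach bimodules, intertwining operators and the continuity ideal -/

section Bimodules

/-- The structure of a Banach `B`-bimodule on a Banach space `X`: commuting bilinear left and right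
actions of the algebra `B` that are jointly continuous. -/
structure BanachBimodule (B X : Type*) [NormedAddCommGroup B] [NormedSpace ℂ B] [Mul B]
    [NormedAddCommGroup X] [NormedSpace ℂ X] where
  /-- `left b ξ` is `b ξ`. -/
  left : B →ₗ[ℂ] X →ₗ[ℂ] X
  /-- `right b ξ` is `ξ b`. -/
  right : B →ₗ[ℂ] X →ₗ[ℂ] X
  continuous_left : Continuous fun p : B × X => left p.1 p.2
  continuous_right : Continuous fun p : X × B => right p.2 p.1
  left_mul : ∀ (a b : B) (ξ : X), left (a * b) ξ = left a (left b ξ)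
  right_mul : ∀ (a b : B) (ξ : X), right (a * b) ξ = right b (right a ξ)
  left_right : ∀ (a b : B) (ξ : X), right b (left a ξ) = left a (right b ξ)

variable {B X₁ X₂ : Type*} [NormedAddCommGroup B] [NormedSpace ℂ B] [Mul B]
  [NormedAddCommGroup X₁] [NormedSpace ℂ X₁] [NormedAddCommGroup X₂] [NormedSpace ℂ X₂]

/-- A linear map `θ` (not assumed to be continuous) is an intertwining operator if, for each `b`,
the maps `ξ ↦ θ(b ξ) - b θ(ξ)` and `ξ ↦ θ(ξ b) - θ(ξ) b` are continuous. -/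
def IsIntertwining (M₁ : BanachBimodule B X₁) (M₂ : BanachBimodule B X₂) (θ : X₁ →ₗ[ℂ] X₂) :
    Prop :=
  ∀ b : B, (Continuous fun ξ => θ (M₁.left b ξ) - M₂.left b (θ ξ)) ∧
    Continuous fun ξ => θ (M₁.right b ξ) - M₂.right b (θ ξ)

/-- The separating space of a linear map. -/
def separatingSpace (θ : X₁ →ₗ[ℂ] X₂) : Set X₂ :=
  {η | ∃ ξ : ℕ → X₁, Tendsto ξ atTop (𝓝 0) ∧ Tendsto (fun n => θ (ξ n)) atTop (𝓝 η)}

/-- The continuity ideal `{b | b S(θ) = S(θ) b = 0}`, where `S(θ)` is the separating space. -/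
def continuityIdeal (M₂ : BanachBimodule B X₂) (θ : X₁ →ₗ[ℂ] X₂) : Submodule ℂ B where
  carrier := {b | ∀ η ∈ separatingSpace θ, M₂.left b η = 0 ∧ M₂.right b η = 0}
  zero_mem' := fun η _ => by simp
  add_mem' {a b} ha hb := fun η hη => by simp [ha η hη, hb η hη]
  smul_mem' c b hb := fun η hη => by simp [hb η hη]

end Bimodules

end

noncomputable section

/-! ### Locally finite von Neumann regular algebras -/

section RegularRing

/-! The separating space S(θ) is a closed subspace of X₂, invariant under both actions of B = L¹(G,
A). The continuity ideal is the intersection of the kernels of the two induced maps from B to the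
bounded operators on S(θ), so it suffices that each map has finite-dimensional range. The left
action is a bounded homomorphism φ. The right action becomes one after passing to the opposite
algebra.

By hypothesis φ has finite-dimensional image on L¹(H, A) for every open compactly generated H, and
these H exhaust the compactly supported functions. A limit of images of a bounded approximate
identity gives each image a unit (`TwistedL1.exists_unit`), and one unit serves all large H. Each
image is von Neumann regular (`TwistedL1.regular_range_compCc`): it is spanned by elements whose
left multiplication is induced by an isometric twisted translation u S_y, with u a unitary
multiplier. These form a bounded group, so Maschke averaging splits off every principal left ideal
equivariantly. Hence the image of C_c(G, A), with scalars adjoined, is regular, and each of its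
elements is algebraic over ℂ (`TwistedL1.regular_unitalRange`).

The only global input is the stability lemma of automatic continuity
(`exists_separatingSpace_stable`), a gliding hump argument: the closures of P_n S(θ) cannot decrease
strictly for ever. So the algebra has no strictly decreasing sequence of idempotents. A regular ring
with this property is semisimple, and a semisimple algebraic algebra over ℂ is finite-dimensional by
Wedderburn–Artin. A finite-dimensional space is closed and C_c(G, A) is dense in L¹(G, A), so φ has
finite-dimensional range. -/

/-- In a von Neumann regular ring, the left ideal generated by an idempotent and a further element
is generated by an idempotent. -/
theorem exists_idempotent_mul_eq_of_regular {R : Type*} [Ring R]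
    (hreg : ∀ a : R, ∃ x, a * x * a = a) (J : Submodule R R) {e b : R}
    (he : IsIdempotentElem e) (heJ : e ∈ J) (hb : b ∈ J) :
    ∃ g ∈ J, IsIdempotentElem g ∧ e * g = e ∧ b * g = b := by
  -- Write b = b e + c with c = b (1 - e). If c y c = c, then f = y c is idempotent with c f = c and
  -- f e = 0, and e + (1 - e) f is a right identity for both e and c.
  obtain ⟨y, hy⟩ := hreg (b * (1 - e))
  obtain ⟨c, hc⟩ : ∃ c, c = b * (1 - e) := ⟨_, rfl⟩
  obtain ⟨f, hf⟩ : ∃ f, f = y * c := ⟨_, rfl⟩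
  have hee : e * e = e := he
  have hce : c * e = 0 := by rw [hc, mul_assoc, sub_mul, hee, one_mul, sub_self, mul_zero]
  have hcf : c * f = c := by rw [hf, ← mul_assoc, hc, hy]
  have hff : f * f = f := by nth_rw 1 [hf]; rw [mul_assoc, hcf, hf]
  have hfe : f * e = 0 := by rw [hf, mul_assoc, hce, mul_zero]
  have heg : e * (e + (1 - e) * f) = e := by
    rw [mul_add, hee, ← mul_assoc, mul_sub, mul_one, hee, sub_self, zero_mul, add_zero]
  have hfg : f * (e + (1 - e) * f) = f := by
    rw [mul_add, hfe, ← mul_assoc, mul_sub, hfe, mul_one, sub_zero, hff, zero_add]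
  have hcg : c * (e + (1 - e) * f) = c := by
    rw [mul_add, hce, ← mul_assoc, mul_sub, hce, mul_one, sub_zero, hcf, zero_add]
  have hcJ : c ∈ J := by
    rw [hc, mul_sub, mul_one]
    exact J.sub_mem hb (J.smul_mem b heJ)
  refine ⟨e + (1 - e) * f, ?_, ?_, heg, ?_⟩
  · exact J.add_mem heJ (J.smul_mem (1 - e) (hf ▸ J.smul_mem y hcJ))
  · change (e + (1 - e) * f) * (e + (1 - e) * f) = _
    rw [add_mul, heg, mul_assoc, hfg]
  · have : b = b * e + c := by rw [hc, mul_sub, mul_one]; abel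
    nth_rw 1 [this]
    rw [add_mul, mul_assoc, heg, hcg, ← this]

/-- A von Neumann regular ring in which decreasing sequences of idempotents (in the sense of their
right ideals) are not strictly decreasing is semisimple. -/
theorem isSemisimpleRing_of_regular {R : Type*} [Ring R]
    (hreg : ∀ a : R, ∃ x, a * x * a = a)
    (hchain : ∀ p : ℕ → R, (∀ n, IsIdempotentElem (p n)) → (∀ n, p n * p (n + 1) = p (n + 1)) →
      ∃ n, p (n + 1) * p n = p n) : IsSemisimpleRing R := by
  -- Here q' is below q when R q is strictly contained in R q', so minimal elements have maximal
  -- left ideals. Increasing left ideals R q correspond to decreasing right ideals (1 - q) R, to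
  -- which `hchain` applies.
  have hwf : WellFounded fun q' q : {q : R // IsIdempotentElem q} =>
      q.1 * q'.1 = q.1 ∧ ¬ q'.1 * q.1 = q'.1 := by
    rw [wellFounded_iff_isEmpty_descending_chain]
    refine ⟨fun ⟨f, hf⟩ => ?_⟩
    obtain ⟨n, hn⟩ := hchain (fun n => 1 - (f n).1) (fun n => (f n).2.one_sub) fun n => by
      have := (hf n).1
      simp only [mul_sub, sub_mul, one_mul, mul_one, this]
      abel
    refine (hf n).2 ?_
    simp only [mul_sub, sub_mul, one_mul, mul_one] at hn
    have h2 : (f (n + 1)).1 * (f n).1 - (f (n + 1)).1 = 0 := by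
      have := sub_eq_zero.2 hn
      rw [← this]
      abel
    exact sub_eq_zero.1 h2
  refine (isSemisimpleModule_iff R R).2 ⟨fun J => ?_⟩
  obtain ⟨⟨g, hg⟩, hgJ, hmin⟩ := hwf.has_min {q | q.1 ∈ J}
    ⟨⟨0, IsIdempotentElem.zero⟩, J.zero_mem⟩
  -- Some idempotent of J absorbs g and b together, and minimality shows that g already absorbs b.
  -- Thus J = R g, with complement R (1 - g).
  have hall : ∀ b ∈ J, b * g = b := by
    intro b hb
    obtain ⟨g', hg'J, hg', h1, h2⟩ := exists_idempotent_mul_eq_of_regular hreg J hg hgJ hb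
    have h3 : g' * g = g' := by
      by_contra h
      exact hmin ⟨g', hg'⟩ hg'J ⟨h1, h⟩
    rw [← h2, mul_assoc, h3]
  refine ⟨Submodule.span R {1 - g}, ?_, ?_⟩
  · rw [Submodule.disjoint_def]
    intro x hx hx'
    obtain ⟨y, rfl⟩ := Submodule.mem_span_singleton.1 hx'
    have h := hall _ hx
    rw [smul_eq_mul, mul_assoc, sub_mul, one_mul, hg.eq, sub_self, mul_zero] at h
    exact h.symm
  · rw [codisjoint_iff, eq_top_iff]
    intro x _
    have : x = x • g + x • (1 - g) := by rw [← smul_add]; simp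
    rw [this]
    exact Submodule.add_mem_sup (J.smul_mem x hgJ)
      (Submodule.smul_mem _ x (Submodule.mem_span_singleton_self _))

/-- A semisimple algebraic algebra over an algebraically closed field is finite-dimensional. -/
theorem finite_of_isSemisimpleRing_of_isIntegral {F R : Type*} [Field F] [IsAlgClosed F] [Ring R]
    [Algebra F R] [IsSemisimpleRing R] (hint : ∀ a : R, IsIntegral F a) : Module.Finite F R := by
  obtain ⟨n, D, d, _, _, hd, ⟨e⟩⟩ := IsSemisimpleRing.exists_algEquiv_pi_matrix_divisionRing F R
  -- Scalar matrices embed the division algebra D i in a Wedderburn factor, so its elements are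
  -- integral over F. As F is algebraically closed, D i = F.
  have key : ∀ i, Module.Finite F (D i) := by
    intro i
    have := hd i
    have hD : Algebra.IsIntegral F (D i) := by
      refine ⟨fun x => ?_⟩
      let ψ : D i →ₐ[F] Matrix (Fin (d i)) (Fin (d i)) (D i) :=
        { Matrix.scalar (Fin (d i)) with
          commutes' := fun r => by
            ext a b
            simp [Matrix.algebraMap_matrix_apply, Matrix.scalar_apply, Matrix.diagonal_apply] }
      have hψ : Function.Injective ψ := fun a b hab => by
        have := congrFun (congrFun hab (0 : Fin (d i))) 0
        simpa [ψ, Matrix.scalar_apply] using this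
      rw [← isIntegral_algHom_iff ψ hψ]
      have h := (hint (e.symm (Pi.single i (ψ x)))).map
        ((Pi.evalAlgHom F (fun i => Matrix (Fin (d i)) (Fin (d i)) (D i)) i).comp e.toAlgHom)
      simpa using h
    have hb := IsAlgClosed.algebraMap_bijective_of_isIntegral (k := F) (K := D i)
    exact Module.Finite.of_surjective (Algebra.linearMap F (D i)) hb.2
  exact Module.Finite.equiv e.symm.toLinearEquiv

end RegularRing

/-! ### Separating spaces -/

section Separating

variable {X₁ X₂ : Type*} [NormedAddCommGroup X₁] [NormedSpace ℂ X₁]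
  [NormedAddCommGroup X₂] [NormedSpace ℂ X₂]

theorem mem_separatingSpace_iff (θ : X₁ →ₗ[ℂ] X₂) (η : X₂) :
    η ∈ separatingSpace θ ↔ ∀ ε > 0, ∃ ξ, ‖ξ‖ < ε ∧ ‖θ ξ - η‖ < ε := by
  constructor
  · rintro ⟨ξ, h0, h1⟩ ε hε
    have h2 := (Metric.tendsto_nhds.1 h0 ε hε).and (Metric.tendsto_nhds.1 h1 ε hε)
    obtain ⟨n, hn, hn'⟩ := h2.exists
    exact ⟨ξ n, by simpa using hn, by simpa [dist_eq_norm] using hn'⟩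
  · intro h
    choose ξ h1 h2 using fun n : ℕ => h (1 / (n + 1)) (by positivity)
    refine ⟨ξ, squeeze_zero_norm (fun n => (h1 n).le) tendsto_one_div_add_atTop_nhds_zero_nat, ?_⟩
    rw [tendsto_iff_norm_sub_tendsto_zero]
    exact squeeze_zero (fun n => norm_nonneg _) (fun n => (h2 n).le)
      tendsto_one_div_add_atTop_nhds_zero_nat

/-- The separating space as a linear subspace. -/
def separatingSubmodule (θ : X₁ →ₗ[ℂ] X₂) : Submodule ℂ X₂ where
  carrier := separatingSpace θ
  zero_mem' := ⟨0, tendsto_const_nhds, by simp⟩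
  add_mem' := by
    rintro a b ⟨ξ, h1, h2⟩ ⟨ζ, h3, h4⟩
    exact ⟨fun n => ξ n + ζ n, by simpa using h1.add h3, by simpa using h2.add h4⟩
  smul_mem' := by
    rintro c a ⟨ξ, h1, h2⟩
    exact ⟨fun n => c • ξ n, by simpa using h1.const_smul c, by simpa using h2.const_smul c⟩

theorem isClosed_separatingSubmodule (θ : X₁ →ₗ[ℂ] X₂) :
    IsClosed (separatingSubmodule θ : Set X₂) := by
  rw [← isSeqClosed_iff_isClosed]
  intro η η₀ h hη
  change η₀ ∈ separatingSpace θ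
  rw [mem_separatingSpace_iff]
  intro ε hε
  obtain ⟨n, hn⟩ := (Metric.tendsto_nhds.1 hη (ε / 2) (by positivity)).exists
  obtain ⟨ξ, h1, h2⟩ := (mem_separatingSpace_iff θ (η n)).1 (h n) (ε / 2) (by positivity)
  refine ⟨ξ, by linarith, ?_⟩
  rw [dist_eq_norm] at hn
  calc ‖θ ξ - η₀‖ = ‖(θ ξ - η n) + (η n - η₀)‖ := by abel_nf
    _ ≤ ‖θ ξ - η n‖ + ‖η n - η₀‖ := norm_add_le _ _
    _ < ε := by linarith

/-- The separating space is invariant under operators that intertwine `θ` up to a continuous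
operator. -/
theorem map_mem_separatingSpace {θ : X₁ →ₗ[ℂ] X₂} (T : X₁ →L[ℂ] X₁) (R : X₂ →L[ℂ] X₂)
    (h : Continuous fun ξ => θ (T ξ) - R (θ ξ)) {η : X₂} (hη : η ∈ separatingSpace θ) :
    R η ∈ separatingSpace θ := by
  obtain ⟨ξ, h0, h1⟩ := hη
  refine ⟨fun n => T (ξ n), by simpa [Function.comp_def] using (T.continuous.tendsto 0).comp h0, ?_⟩
  have h2 := (h.tendsto 0).comp h0
  have h3 := (R.continuous.tendsto η).comp h1
  simpa [Function.comp_def] using h2.add h3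

/-- Closed graph theorem. If u n → x and θ (u n) → w modulo S(θ), a small correction ζ taken from
the definition of S(θ) makes θ (u n - x + ζ) close to w - θ x, so this vector lies in S(θ). -/
theorem continuous_mkQ_separatingSubmodule [CompleteSpace X₁] [CompleteSpace X₂]
    (θ : X₁ →ₗ[ℂ] X₂) : Continuous fun ξ => (separatingSubmodule θ).mkQ (θ ξ) := by
  have hcl : IsClosed (separatingSubmodule θ : Set X₂) := isClosed_separatingSubmodule θ
  refine LinearMap.continuous_of_seq_closed_graph ((separatingSubmodule θ).mkQ ∘ₗ θ) ?_
  intro u x y hu hy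
  obtain ⟨w, rfl⟩ := Submodule.Quotient.mk_surjective _ y
  suffices w - θ x ∈ separatingSpace θ by
    exact (Submodule.Quotient.eq _).2 this
  rw [mem_separatingSpace_iff]
  intro ε hε
  have h1 := (Metric.tendsto_nhds.1 hu (ε / 2) (by positivity))
  have h2 := (Metric.tendsto_nhds.1 hy (ε / 4) (by positivity))
  obtain ⟨n, hn1, hn2⟩ := (h1.and h2).exists
  rw [dist_eq_norm] at hn1 hn2
  have h3 : ‖(Submodule.Quotient.mk (θ (u n) - w) : X₂ ⧸ separatingSubmodule θ)‖ < ε / 4 := hn2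
  obtain ⟨m, hm, hm'⟩ := Submodule.Quotient.norm_mk_lt
    (S := separatingSubmodule θ) (Submodule.Quotient.mk (θ (u n) - w)) (ε := ε / 4) (by positivity)
  have hs : m - (θ (u n) - w) ∈ separatingSpace θ := (Submodule.Quotient.eq _).1 hm
  obtain ⟨ζ, hζ, hζ'⟩ := (mem_separatingSpace_iff θ _).1 hs (ε / 2) (by positivity)
  refine ⟨u n - x + ζ, (norm_add_le _ _).trans_lt (by linarith), ?_⟩
  have : θ (u n - x + ζ) - (w - θ x) = (θ ζ - (m - (θ (u n) - w))) + m := by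
    simp only [map_add, map_sub]; abel
  rw [this]
  exact (norm_add_le _ _).trans_lt (by linarith)

/-- A bounded operator `q` makes `q ∘ θ` continuous exactly if it vanishes on the separating
space. -/
theorem continuous_comp_iff_separatingSpace [CompleteSpace X₁] [CompleteSpace X₂]
    {Z : Type*} [NormedAddCommGroup Z] [NormedSpace ℂ Z]
    (θ : X₁ →ₗ[ℂ] X₂) (q : X₂ →L[ℂ] Z) :
    (Continuous fun ξ => q (θ ξ)) ↔ ∀ η ∈ separatingSpace θ, q η = 0 := by
  constructor
  · rintro h η ⟨ξ, h0, h1⟩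
    have h2 := (h.tendsto 0).comp h0
    have h3 := (q.continuous.tendsto η).comp h1
    simpa using tendsto_nhds_unique h3 h2
  · intro h
    have hle : separatingSubmodule θ ≤ LinearMap.ker (q : X₂ →ₗ[ℂ] Z) := fun η hη => h η hη
    have hc : Continuous ((separatingSubmodule θ).liftQ (q : X₂ →ₗ[ℂ] Z) hle) :=
      (Submodule.isQuotientMap_mkQ _).continuous_iff.2 q.continuous
    exact hc.comp (continuous_mkQ_separatingSubmodule θ)

theorem exists_norm_lt_of_not_continuous {E F : Type*} [NormedAddCommGroup E] [NormedSpace ℂ E]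
    [NormedAddCommGroup F] [NormedSpace ℂ F] (g : E →ₗ[ℂ] F) (hg : ¬ Continuous g) {δ : ℝ}
    (hδ : 0 < δ) (C : ℝ) : ∃ x, ‖x‖ ≤ δ ∧ C < ‖g x‖ := by
  by_contra! h
  refine hg (AddMonoidHomClass.continuous_of_bound g (C / δ) fun x => ?_)
  rcases eq_or_ne x 0 with rfl | hx
  · simp
  have hx' : 0 < ‖x‖ := norm_pos_iff.2 hx
  have h1 := h (((δ / ‖x‖ : ℝ) : ℂ) • x) (by
    rw [norm_smul, Complex.norm_real, Real.norm_of_nonneg (by positivity)]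
    field_simp
    exact le_rfl)
  rw [map_smul, norm_smul, Complex.norm_real, Real.norm_of_nonneg (by positivity)] at h1
  rw [div_mul_eq_mul_div, le_div_iff₀ hδ]
  rw [div_mul_eq_mul_div, div_le_iff₀ hx'] at h1
  linarith

/-- If `x n` is small compared to the operators `T 0, …, T (n - 1)`, then there are vectors `z n`
of norm at most one with `z n = x n + T n (z (n + 1))`. -/
theorem exists_backward_sum {E : Type*} [NormedAddCommGroup E] [NormedSpace ℂ E] [CompleteSpace E]
    (T : ℕ → E →L[ℂ] E) (x : ℕ → E)
    (hx : ∀ n, ‖x n‖ ≤ (1 / 2) ^ (n + 1) / ∏ i ∈ Finset.range n, (1 + ‖T i‖)) :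
    ∃ z : ℕ → E, (∀ n, ‖z n‖ ≤ 1) ∧ ∀ n, z n = x n + T n (z (n + 1)) := by
  -- W m k = T m ⋯ T (m + k - 1), and z m is the sum over k of W m k (x (m + k)), a series dominated
  -- by a geometric one.
  let W : ℕ → ℕ → E →L[ℂ] E := fun m k =>
    Nat.rec (fun _ => 1) (fun _ V m => T m * V (m + 1)) k m
  have hW : ∀ m k, ‖W m k‖ * ∏ i ∈ Finset.range m, (1 + ‖T i‖) ≤
      ∏ i ∈ Finset.range (m + k), (1 + ‖T i‖) := by
    intro m k
    have hpos : ∀ m, 0 ≤ ∏ i ∈ Finset.range m, (1 + ‖T i‖) :=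
      fun m => Finset.prod_nonneg fun i _ => by positivity
    induction k generalizing m with
    | zero => exact mul_le_of_le_one_left (hpos m) ContinuousLinearMap.norm_id_le
    | succ k ih =>
      have h1 := ih (m + 1)
      rw [Finset.prod_range_succ] at h1
      rw [show m + (k + 1) = m + 1 + k by ring]
      refine le_trans ?_ h1
      have h2 : ‖W m (k + 1)‖ ≤ ‖T m‖ * ‖W (m + 1) k‖ := norm_mul_le _ _
      calc ‖W m (k + 1)‖ * ∏ i ∈ Finset.range m, (1 + ‖T i‖)
          ≤ ((1 + ‖T m‖) * ‖W (m + 1) k‖) * ∏ i ∈ Finset.range m, (1 + ‖T i‖) := by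
            refine mul_le_mul_of_nonneg_right (h2.trans ?_) (hpos m)
            exact mul_le_mul_of_nonneg_right (by linarith) (norm_nonneg _)
        _ = _ := by ring
  have hb : ∀ m k, ‖W m k (x (m + k))‖ ≤ (1 / 2) ^ (k + 1) := by
    intro m k
    have hp : ∀ m, 0 < ∏ i ∈ Finset.range m, (1 + ‖T i‖) :=
      fun m => Finset.prod_pos fun i _ => by positivity
    have hp1 : 1 ≤ ∏ i ∈ Finset.range m, (1 + ‖T i‖) :=
      Finset.prod_induction _ (fun r => 1 ≤ r) (fun _ _ => one_le_mul_of_one_le_of_one_le) le_rfl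
        fun i _ => by linarith [norm_nonneg (T i)]
    have h1 : ‖W m k‖ ≤ ∏ i ∈ Finset.range (m + k), (1 + ‖T i‖) :=
      (le_mul_of_one_le_right (norm_nonneg _) hp1).trans (hW m k)
    calc ‖W m k (x (m + k))‖ ≤ ‖W m k‖ * ‖x (m + k)‖ := (W m k).le_opNorm _
      _ ≤ (∏ i ∈ Finset.range (m + k), (1 + ‖T i‖)) *
          ((1 / 2) ^ (m + k + 1) / ∏ i ∈ Finset.range (m + k), (1 + ‖T i‖)) :=
        mul_le_mul h1 (hx _) (norm_nonneg _) (hp _).le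
      _ = (1 / 2) ^ (m + k + 1) := mul_div_cancel₀ _ (hp _).ne'
      _ ≤ (1 / 2) ^ (k + 1) := pow_le_pow_of_le_one (by norm_num) (by norm_num) (by omega)
  have hg : HasSum (fun k : ℕ => ((1 : ℝ) / 2) ^ (k + 1)) 1 := by
    have := hasSum_geometric_two.mul_left (1 / 2 : ℝ)
    simpa [pow_succ, mul_comm] using this
  have hs : ∀ m, Summable fun k => W m k (x (m + k)) :=
    fun m => Summable.of_norm_bounded hg.summable (hb m)
  refine ⟨fun m => ∑' k, W m k (x (m + k)), fun m => tsum_of_norm_bounded hg (hb m), fun m => ?_⟩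
  change ∑' k, W m k (x (m + k)) = x m + T m (∑' k, W (m + 1) k (x (m + 1 + k)))
  rw [(hs m).tsum_eq_zero_add, (T m).map_tsum (hs (m + 1))]
  congr 1
  refine tsum_congr fun k => ?_
  rw [show m + (k + 1) = m + 1 + k by ring]
  rfl

/-- The stability lemma of automatic continuity theory: for operators `T n`, `R n` that intertwine
`θ` up to a continuous operator, the closed subspaces generated by the images of the separating
space under `P n = R 0 ⋯ R (n - 1)` do not decrease strictly. -/
theorem exists_separatingSpace_stable [CompleteSpace X₁] [CompleteSpace X₂]
    (θ : X₁ →ₗ[ℂ] X₂) (T : ℕ → X₁ →L[ℂ] X₁) (R P : ℕ → X₂ →L[ℂ] X₂)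
    (hTR : ∀ n, Continuous fun ξ => θ (T n ξ) - R n (θ ξ))
    (hP0 : P 0 = 1) (hP : ∀ n, P (n + 1) = P n * R n) :
    ∃ n, ∀ η ∈ separatingSpace θ, P n η ∈ closure (P (n + 1) '' separatingSpace θ) := by
  -- Gliding hump. With t n = T 0 ⋯ T (n - 1), the map θ ∘ t n is continuous modulo S n but, if
  -- stability fails, not modulo S (n + 1). A single vector z 0, assembled from humps t n (x n),
  -- then has image of norm at least n for every n.
  by_contra! hcon
  obtain ⟨t, ht0, ht⟩ : ∃ t : ℕ → X₁ →L[ℂ] X₁, t 0 = 1 ∧ ∀ n, t (n + 1) = t n * T n :=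
    ⟨fun n => Nat.rec 1 (fun n s => s * T n) n, rfl, fun n => rfl⟩
  let S : ℕ → Submodule ℂ X₂ := fun n =>
    ((separatingSubmodule θ).map (P n : X₂ →ₗ[ℂ] X₂)).topologicalClosure
  have hScl : ∀ n, IsClosed (S n : Set X₂) := fun n => Submodule.isClosed_topologicalClosure _
  have hSmem : ∀ n η, η ∈ S n ↔ η ∈ closure (P n '' separatingSpace θ) := fun n η => Iff.rfl
  have hdiff : ∀ n, Continuous fun ξ => θ (t n ξ) - P n (θ ξ) := by
    intro n
    induction n with
    | zero => simpa [ht0, hP0] using continuous_const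
    | succ n ih =>
      have h1 := (ih.comp (T n).continuous).add ((P n).continuous.comp (hTR n))
      refine h1.congr fun ξ => ?_
      simp only [Pi.add_apply, Function.comp_apply, ht, hP, mul_apply_eq_comp, map_sub]
      abel
  have hcongr : ∀ m n, (Continuous fun ξ => (S m).mkQ (θ (t n ξ))) ↔
      ∀ η ∈ separatingSpace θ, P n η ∈ S m := by
    intro m n
    have h1 : Continuous fun ξ => (S m).mkQ (θ (t n ξ) - P n (θ ξ)) :=
      (S m).continuous_mkQ.comp (hdiff n)
    have h2 := continuous_comp_iff_separatingSpace θ ((S m).mkQL ∘L P n)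
    simp only [ContinuousLinearMap.comp_apply, Submodule.mkQL_apply, Submodule.mkQ_apply,
      Submodule.Quotient.mk_eq_zero] at h2
    rw [← h2]
    constructor
    · intro h
      refine (h.sub h1).congr fun ξ => ?_
      simp
    · intro h
      refine (h.add h1).congr fun ξ => ?_
      simp
  have hA : ∀ n, Continuous ((S n).mkQ ∘ₗ θ ∘ₗ (t n : X₁ →ₗ[ℂ] X₁)) := fun n =>
    (hcongr n n).2 fun η hη => subset_closure ⟨η, hη, rfl⟩
  have hB : ∀ n, ¬ Continuous ((S (n + 1)).mkQ ∘ₗ θ ∘ₗ (t n : X₁ →ₗ[ℂ] X₁)) := fun n h => by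
    obtain ⟨η, hη, hη'⟩ := hcon n
    exact hη' ((hcongr (n + 1) n).1 h η hη)
  let A : ∀ n, X₁ →L[ℂ] X₂ ⧸ S n := fun n => ⟨(S n).mkQ ∘ₗ θ ∘ₗ (t n : X₁ →ₗ[ℂ] X₁), hA n⟩
  -- The hump must dominate, modulo S (n + 1), the head w fixed before it and the tail t (n + 1) (z
  -- (n + 1)). The latter costs at most ‖A (n + 1)‖ because ‖z (n + 1)‖ ≤ 1.
  have hex : ∀ (n : ℕ) (w : X₁), ∃ x,
      ‖x‖ ≤ (1 / 2) ^ (n + 1) / ∏ i ∈ Finset.range n, (1 + ‖T i‖) ∧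
      n + ‖(S (n + 1)).mkQ (θ w)‖ + ‖A (n + 1)‖ < ‖(S (n + 1)).mkQ (θ (t n x))‖ := fun n w =>
    exists_norm_lt_of_not_continuous _ (hB n)
      (div_pos (by positivity) (Finset.prod_pos fun i _ => by positivity)) _
  choose x hx1 hx2 using hex
  let w : ℕ → X₁ := fun n => Nat.rec 0 (fun n v => v + t n (x n v)) n
  have hw : ∀ n, w (n + 1) = w n + t n (x n (w n)) := fun n => rfl
  obtain ⟨z, hz1, hz2⟩ := exists_backward_sum T (fun n => x n (w n)) fun n => hx1 n _
  have hz : ∀ n, z 0 = w n + t n (z n) := by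
    intro n
    induction n with
    | zero => simp [w, ht0]
    | succ n ih =>
      rw [ih, hw, hz2 n, ht, map_add, mul_apply_eq_comp, add_assoc]
  have hbig : ∀ n : ℕ, (n : ℝ) ≤ ‖θ (z 0)‖ := by
    intro n
    have h1 : (S (n + 1)).mkQ (θ (z 0)) = (S (n + 1)).mkQ (θ (t n (x n (w n)))) +
        (S (n + 1)).mkQ (θ (w n)) + A (n + 1) (z (n + 1)) := by
      change _ = _ + _ + (S (n + 1)).mkQ (θ (t (n + 1) (z (n + 1))))
      rw [hz (n + 1), hw, ← map_add, ← map_add, ← map_add, ← map_add]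
      congr 2
      abel
    have h2 : ‖A (n + 1) (z (n + 1))‖ ≤ ‖A (n + 1)‖ :=
      ((A (n + 1)).le_opNorm _).trans (mul_le_of_le_one_right (norm_nonneg _) (hz1 _))
    have h3 : ‖(S (n + 1)).mkQ (θ (z 0))‖ ≤ ‖θ (z 0)‖ := Submodule.Quotient.norm_mk_le _ _
    have h4 := hx2 n (w n)
    have h5 : ‖(S (n + 1)).mkQ (θ (t n (x n (w n))))‖ ≤ ‖(S (n + 1)).mkQ (θ (z 0))‖ +
        (‖(S (n + 1)).mkQ (θ (w n))‖ + ‖A (n + 1) (z (n + 1))‖) := by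
      have : (S (n + 1)).mkQ (θ (t n (x n (w n)))) = (S (n + 1)).mkQ (θ (z 0)) -
          ((S (n + 1)).mkQ (θ (w n)) + A (n + 1) (z (n + 1))) := by rw [h1]; abel
      rw [this]
      exact (norm_sub_le _ _).trans (by gcongr; exact norm_add_le _ _)
    linarith
  obtain ⟨n, hn⟩ := exists_nat_gt ‖θ (z 0)‖
  exact absurd (hbig n) (not_le.2 hn)

end Separating

/-! ### Bounded groups of operators on finite-dimensional spaces -/

section BoundedGroups

variable {V : Type*} [NormedAddCommGroup V] [NormedSpace ℂ V] [FiniteDimensional ℂ V]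

theorem norm_le_of_mem_topologicalClosure {V : Type*} [NormedAddCommGroup V] [NormedSpace ℂ V]
    {Γ : Subgroup (V →L[ℂ] V)ˣ} {C : ℝ}
    (hC : ∀ g ∈ Γ, ‖(g : V →L[ℂ] V)‖ ≤ C) : ∀ g ∈ Γ.topologicalClosure,
      ‖(g : V →L[ℂ] V)‖ ≤ C := fun _ hg =>
  closure_minimal (s := (Γ : Set (V →L[ℂ] V)ˣ)) (t := {g | ‖(g : V →L[ℂ] V)‖ ≤ C}) hC
    (isClosed_le (continuous_norm.comp Units.continuous_val) continuous_const) hg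

/-- As Γ is a group, the bound holds for g and g⁻¹ alike. The embedding g ↦ (g, g⁻¹) of the units is
closed, and it sends the closure of Γ into a product of two compact balls. -/
theorem isCompact_topologicalClosure_of_bounded
    (Γ : Subgroup (V →L[ℂ] V)ˣ) {C : ℝ} (hC : ∀ g ∈ Γ, ‖(g : V →L[ℂ] V)‖ ≤ C) :
    IsCompact (Γ.topologicalClosure : Set (V →L[ℂ] V)ˣ) := by
  have : ProperSpace (V →L[ℂ] V) := FiniteDimensional.proper ℂ _
  have hB : IsCompact (Metric.closedBall (0 : V →L[ℂ] V) C) := isCompact_closedBall _ _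
  have hcomp : IsCompact (Units.embedProduct (V →L[ℂ] V) ⁻¹'
      (Metric.closedBall 0 C ×ˢ (MulOpposite.op '' Metric.closedBall 0 C))) :=
    Units.isClosedEmbedding_embedProduct.isCompact_preimage
      (hB.prod (hB.image MulOpposite.continuous_op))
  refine hcomp.of_isClosed_subset Γ.isClosed_topologicalClosure fun g hg => ?_
  have h1 := norm_le_of_mem_topologicalClosure hC g hg
  have h2 := norm_le_of_mem_topologicalClosure hC g⁻¹ (inv_mem hg)
  exact ⟨by simpa using h1, ⟨_, by simpa using h2, rfl⟩⟩

/-- Maschke's theorem for bounded groups of operators. -/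
theorem exists_equivariant_projection
    (Γ : Subgroup (V →L[ℂ] V)ˣ) {C : ℝ} (hC : ∀ g ∈ Γ, ‖(g : V →L[ℂ] V)‖ ≤ C)
    (W : Submodule ℂ V) (hW : ∀ g ∈ Γ, ∀ w ∈ W, (g : V →L[ℂ] V) w ∈ W) :
    ∃ P : V →L[ℂ] V, (∀ v, P v ∈ W) ∧ (∀ w ∈ W, P w = w) ∧
      ∀ g ∈ Γ, ∀ v, P ((g : V →L[ℂ] V) v) = (g : V →L[ℂ] V) (P v) := by
  obtain ⟨P₀', hP₀'⟩ := W.exists_isCompl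
  obtain ⟨P₀, hP₀W, hP₀⟩ : ∃ P₀ : V →L[ℂ] V, (∀ v, P₀ v ∈ W) ∧ ∀ w ∈ W, P₀ w = w := by
    refine ⟨LinearMap.toContinuousLinearMap (W.subtype ∘ₗ W.projectionOnto P₀' hP₀'),
      fun v => ?_, fun w hw => ?_⟩
    · simp
    · exact congrArg Subtype.val (Submodule.projectionOnto_apply_left hP₀' ⟨w, hw⟩)
  let K := Γ.topologicalClosure
  have : CompactSpace K :=
    isCompact_iff_compactSpace.1 (isCompact_topologicalClosure_of_bounded Γ hC)
  have hWcl : IsClosed (W : Set V) := W.closed_of_finiteDimensional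
  have hWK : ∀ g ∈ K, ∀ w ∈ W, (g : V →L[ℂ] V) w ∈ W := by
    intro g hg w hw
    refine closure_minimal (s := (Γ : Set (V →L[ℂ] V)ˣ))
      (t := {g : (V →L[ℂ] V)ˣ | (g : V →L[ℂ] V) w ∈ W}) (fun g hg => hW g hg w hw) ?_ hg
    exact hWcl.preimage ((ContinuousLinearMap.apply ℂ V w).continuous.comp Units.continuous_val)
  borelize ↥K
  let μ : Measure K := Measure.haar
  -- Averaging g P₀ g⁻¹ over the compact closure of Γ and dividing by the total mass gives the
  -- equivariant projection.
  let f : K → V →L[ℂ] V := fun g =>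
    ((g : (V →L[ℂ] V)ˣ) : V →L[ℂ] V) * P₀ * ((g⁻¹ : K) : (V →L[ℂ] V)ˣ)
  have hval : Continuous fun g : K => ((g : (V →L[ℂ] V)ˣ) : V →L[ℂ] V) :=
    Units.continuous_val.comp continuous_subtype_val
  have hf : Continuous f := (hval.mul continuous_const).mul (hval.comp continuous_inv)
  have hfi : Integrable f μ := hf.integrable_of_hasCompactSupport (HasCompactSupport.of_compactSpace f)
  have hinv : ∀ g : K, ((g : (V →L[ℂ] V)ˣ) : V →L[ℂ] V) * (((g⁻¹ : K) : (V →L[ℂ] V)ˣ) : V →L[ℂ] V)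
      = 1 := fun g => by simp
  have hinv' : ∀ g : K, (((g⁻¹ : K) : (V →L[ℂ] V)ˣ) : V →L[ℂ] V) * ((g : (V →L[ℂ] V)ˣ) : V →L[ℂ] V)
      = 1 := fun g => by simp
  have hc : μ.real Set.univ ≠ 0 := by
    have h1 : μ Set.univ ≠ 0 := (isOpen_univ.measure_pos μ Set.univ_nonempty).ne'
    have h2 : μ Set.univ ≠ ⊤ := isCompact_univ.measure_lt_top.ne
    exact ENNReal.toReal_ne_zero.2 ⟨h1, h2⟩
  let I : V →L[ℂ] V := ∫ g, f g ∂μ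
  have hI : ∀ v, I v = ∫ g, f g v ∂μ := fun v =>
    ((ContinuousLinearMap.apply ℂ V v).integral_comp_comm hfi).symm
  have hfW : ∀ g v, f g v ∈ W := fun g v => hWK _ g.2 _ (hP₀W _)
  have hfid : ∀ g, ∀ w ∈ W, f g w = w := fun g w hw => by
    have h1 : (((g⁻¹ : K) : (V →L[ℂ] V)ˣ) : V →L[ℂ] V) w ∈ W := hWK _ (g⁻¹).2 w hw
    change ((g : (V →L[ℂ] V)ˣ) : V →L[ℂ] V) (P₀ ((((g⁻¹ : K) : (V →L[ℂ] V)ˣ) : V →L[ℂ] V) w)) = w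
    rw [hP₀ _ h1]
    exact DFunLike.congr_fun (hinv g) w
  have hmul : ∀ g h : K, f (g * h) * ((g : (V →L[ℂ] V)ˣ) : V →L[ℂ] V) =
      ((g : (V →L[ℂ] V)ˣ) : V →L[ℂ] V) * f h := fun g h => by
    simp only [f, mul_inv_rev, Subgroup.coe_mul, Units.val_mul]
    rw [mul_assoc, mul_assoc (((h⁻¹ : K) : (V →L[ℂ] V)ˣ) : V →L[ℂ] V), hinv', mul_one]
    simp only [mul_assoc]
  have hequiv : ∀ g : K, I * ((g : (V →L[ℂ] V)ˣ) : V →L[ℂ] V) =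
      ((g : (V →L[ℂ] V)ˣ) : V →L[ℂ] V) * I := fun g => by
    have h1 : I = ∫ h, f (g * h) ∂μ := (integral_mul_left_eq_self f g).symm
    have h2 : Integrable (fun h => f (g * h)) μ :=
      (hf.comp (continuous_const_mul g)).integrable_of_hasCompactSupport
        (HasCompactSupport.of_compactSpace _)
    nth_rw 1 [h1]
    rw [← integral_mul_const_of_integrable h2, ← integral_const_mul_of_integrable hfi]
    exact integral_congr_ae (Eventually.of_forall fun h => hmul g h)
  refine ⟨(((μ.real Set.univ)⁻¹ : ℝ) : ℂ) • I, fun v => ?_, fun w hw => ?_, fun g hg v => ?_⟩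
  · refine W.smul_mem _ ?_
    change I v ∈ W
    rw [hI]
    have hq : (W.mkQ) (∫ g, f g v ∂μ) = 0 := by
      have h3 := (W.mkQL).integral_comp_comm
        ((ContinuousLinearMap.apply ℂ V v).integrable_comp hfi)
      have h4 : ∀ g, W.mkQL (ContinuousLinearMap.apply ℂ V v (f g)) = 0 := fun g => by
        simpa using hfW g v
      simp only [h4, integral_zero] at h3
      exact h3.symm
    simpa using hq
  · rw [smul_apply, hI]
    simp only [hfid _ w hw, integral_const]
    rw [← Complex.coe_smul, smul_smul, ← Complex.ofReal_mul, inv_mul_cancel₀ hc]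
    simp
  · have := DFunLike.congr_fun (hequiv ⟨g, Γ.le_topologicalClosure hg⟩) v
    simp only [smul_apply, map_smul]
    congr 1

/-- A finite-dimensional image of a normed space is a von Neumann regular algebra if it is spanned
by elements that implement invertible isometries of the space. -/
theorem regular_of_isometries {E F R : Type*} [AddCommGroup E] [Module ℂ E]
    [NormedAddCommGroup F] [NormedSpace ℂ F] [NormedRing R] [NormedAlgebra ℂ R]
    (ι : E →ₗ[ℂ] F) (φ : F →L[ℂ] R) (π : E →ₗ[ℂ] R) (hπ : ∀ x, π x = φ (ι x))
    [FiniteDimensional ℂ (LinearMap.range π)]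
    (hmul : ∀ a ∈ LinearMap.range π, ∀ b ∈ LinearMap.range π, a * b ∈ LinearMap.range π)
    {e : R} (he : e ∈ LinearMap.range π) (hae : ∀ a ∈ LinearMap.range π, e * a = a ∧ a * e = a)
    (hspan : LinearMap.range π ≤ Submodule.span ℂ {k | k ∈ LinearMap.range π ∧ ∃ L : E ≃ₗ[ℂ] E,
      (∀ x, ‖ι (L x)‖ = ‖ι x‖) ∧ ∀ x, π (L x) = k * π x})
    {a : R} (ha : a ∈ LinearMap.range π) : ∃ x ∈ LinearMap.range π, a * x * a = a := by
  let V := LinearMap.range π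
  let p : E →ₗ[ℂ] V := π.rangeRestrict
  obtain ⟨s, hs⟩ := p.exists_rightInverse_of_surjective π.range_rangeRestrict
  let W : Submodule ℂ V :=
    { carrier := {q | ∃ x ∈ V, (q : R) = x * a}
      zero_mem' := ⟨0, V.zero_mem, by simp⟩
      add_mem' := by
        rintro _ _ ⟨x, hx, h⟩ ⟨y, hy, h'⟩
        exact ⟨x + y, V.add_mem hx hy, by simp [h, h', add_mul]⟩
      smul_mem' := by
        rintro c _ ⟨x, hx, h⟩
        exact ⟨c • x, V.smul_mem c hx, by simp [h]⟩ }
  -- Preservation of W is imposed as an equivalence so that inverses stay in Γ.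
  let Γ : Subgroup (V →L[ℂ] V)ˣ :=
    { carrier := {g | (∃ L : E ≃ₗ[ℂ] E, (∀ x, ‖ι (L x)‖ = ‖ι x‖) ∧
        ∀ x, (g : V →L[ℂ] V) (p x) = p (L x)) ∧ ∀ w, (g : V →L[ℂ] V) w ∈ W ↔ w ∈ W}
      one_mem' := ⟨⟨LinearEquiv.refl ℂ E, by simp, by simp⟩, by simp⟩
      mul_mem' := by
        rintro g h ⟨⟨L, h1, h2⟩, h3⟩ ⟨⟨M, h4, h5⟩, h6⟩
        refine ⟨⟨M.trans L, fun x => ?_, fun x => ?_⟩, fun w => ?_⟩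
        · simp [h1, h4]
        · simp [h2, h5]
        · simp [h3, h6]
      inv_mem' := by
        rintro g ⟨⟨L, h1, h2⟩, h3⟩
        have hinv : ∀ v, (g : V →L[ℂ] V) (((g⁻¹ : (V →L[ℂ] V)ˣ) : V →L[ℂ] V) v) = v := fun v =>
          DFunLike.congr_fun (Units.mul_inv g) v
        have hinv' : ∀ v, ((g⁻¹ : (V →L[ℂ] V)ˣ) : V →L[ℂ] V) ((g : V →L[ℂ] V) v) = v := fun v =>
          DFunLike.congr_fun (Units.inv_mul g) v
        refine ⟨⟨L.symm, fun x => ?_, fun x => ?_⟩, fun w => ?_⟩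
        · simpa using (h1 (L.symm x)).symm
        · rw [← hinv' (p (L.symm x)), h2]
          simp
        · rw [← h3, hinv] }
  -- Lifting v by the linear section s costs a factor ‖c‖, finite since V is finite-dimensional. The
  -- isometry L costs nothing and φ costs ‖φ‖, so the bound is uniform over Γ.
  let c := (LinearMap.toContinuousLinearMap (ι ∘ₗ s))
  have hC : ∀ g ∈ Γ, ‖(g : V →L[ℂ] V)‖ ≤ ‖φ‖ * ‖c‖ := by
    rintro g ⟨⟨L, h1, h2⟩, -⟩
    refine ContinuousLinearMap.opNorm_le_bound _ (by positivity) fun v => ?_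
    have h3 : (g : V →L[ℂ] V) v = p (L (s v)) := by
      rw [← h2]
      exact congrArg _ (DFunLike.congr_fun hs v).symm
    rw [h3]
    calc ‖p (L (s v))‖ = ‖φ (ι (L (s v)))‖ := congrArg norm (hπ _)
      _ ≤ ‖φ‖ * ‖ι (L (s v))‖ := φ.le_opNorm _
      _ = ‖φ‖ * ‖c v‖ := by rw [h1]; rfl
      _ ≤ ‖φ‖ * (‖c‖ * ‖v‖) := by gcongr; exact c.le_opNorm v
      _ = _ := by ring
  obtain ⟨P, hPW, hPid, hP⟩ := exists_equivariant_projection Γ hC W fun g hg w hw => (hg.2 w).2 hw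
  -- P commutes with left multiplication by the spanning elements and, by linearity, by all of V.
  -- Membership in V is carried through the induction because P is defined only on V.
  have hPk : ∀ k ∈ V, k ∈ V ∧ ∀ v v' : V, (v' : R) = k * v → (P v' : R) = k * P v := by
    intro k hk
    have hk' := hspan hk
    clear hk
    induction hk' using Submodule.span_induction with
    | zero =>
      refine ⟨V.zero_mem, fun v v' h => ?_⟩
      have : v' = 0 := Subtype.ext (by simpa using h)
      simp [this]
    | smul r k hk ih =>
      refine ⟨V.smul_mem r ih.1, fun v v' h => ?_⟩
      have h1 := ih.2 v ⟨k * v, hmul _ ih.1 _ v.2⟩ rfl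
      have h2 : v' = r • (⟨k * v, hmul _ ih.1 _ v.2⟩ : V) := Subtype.ext (by simpa using h)
      rw [h2, map_smul, Submodule.coe_smul, h1, smul_mul_assoc]
    | add k l hk hl ih1 ih2 =>
      refine ⟨V.add_mem ih1.1 ih2.1, fun v v' h => ?_⟩
      have h1 := ih1.2 v ⟨k * v, hmul _ ih1.1 _ v.2⟩ rfl
      have h2 := ih2.2 v ⟨l * v, hmul _ ih2.1 _ v.2⟩ rfl
      have h3 : v' = (⟨k * v, hmul _ ih1.1 _ v.2⟩ : V) + ⟨l * v, hmul _ ih2.1 _ v.2⟩ :=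
        Subtype.ext (by simpa [add_mul] using h)
      rw [h3, map_add, Submodule.coe_add, h1, h2, add_mul]
    | mem k hk =>
      obtain ⟨hkV, L, hL1, hL2⟩ := hk
      refine ⟨hkV, ?_⟩
      let m : V →ₗ[ℂ] V := (LinearMap.mulLeft ℂ k).restrict fun v hv => hmul _ hkV _ hv
      have hm : ∀ x, m (p x) = p (L x) := fun x => Subtype.ext (hL2 x).symm
      have hsurj : Function.Surjective m := fun v => by
        refine ⟨p (L.symm (s v)), ?_⟩
        rw [hm, LinearEquiv.apply_symm_apply]
        exact DFunLike.congr_fun hs v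
      have hinj : Function.Injective m := LinearMap.injective_iff_surjective.2 hsurj
      let u : V ≃L[ℂ] V := (LinearEquiv.ofBijective m ⟨hinj, hsurj⟩).toContinuousLinearEquiv
      have hu : ∀ v, u v = m v := fun v => rfl
      -- W is a left ideal, so m maps it into itself; injectivity and a dimension count give
      -- equality.
      have hmW : W.map m = W := by
        refine Submodule.eq_of_le_of_finrank_eq ?_
          (LinearEquiv.finrank_map_eq (LinearEquiv.ofBijective m ⟨hinj, hsurj⟩) W)
        rintro _ ⟨w, ⟨x, hx, hw⟩, rfl⟩
        exact ⟨k * x, hmul _ hkV _ hx, by rw [mul_assoc, ← hw]; rfl⟩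
      have huΓ : (ContinuousLinearEquiv.unitsEquiv ℂ V).symm u ∈ Γ := by
        refine ⟨⟨L, hL1, hm⟩, fun w => ⟨fun h => ?_, fun h => ?_⟩⟩
        · have h' : m w ∈ W.map m := by rw [hmW]; exact h
          obtain ⟨w', hw', hww⟩ := h'
          rwa [← hinj hww]
        · rw [← hmW]
          exact ⟨w, h, rfl⟩
      intro v v' h
      have h1 := hP _ huΓ v
      have h2 : v' = m v := Subtype.ext h
      rw [h2]
      exact congrArg Subtype.val h1
  -- Since a = e a lies in W = V a and P e = x a, one gets a = P a = P (a e) = a P e = a x a.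
  obtain ⟨x, hx, hxa⟩ := hPW ⟨e, he⟩
  refine ⟨x, hx, ?_⟩
  have h1 := (hPk a ha).2 ⟨e, he⟩ ⟨a, ha⟩ (hae a ha).2.symm
  rw [hxa, hPid ⟨a, ha⟩ ⟨e, he, (hae a ha).1.symm⟩] at h1
  rw [mul_assoc]
  exact h1.symm

end BoundedGroups

/-! ### Multipliers -/

section Multipliers

variable {A : Type*} [NonUnitalCStarAlgebra A]

theorem norm_coe_multiplier (a : A) : ‖(a : 𝓜(ℂ, A))‖ = ‖a‖ := by
  rw [← DoubleCentralizer.norm_fst, DoubleCentralizer.coe_fst]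
  exact ContinuousLinearMap.opNorm_mul_apply ℂ A a

theorem coe_multiplier_mul (a b : A) :
    ((a * b : A) : 𝓜(ℂ, A)) = (a : 𝓜(ℂ, A)) * (b : 𝓜(ℂ, A)) :=
  map_mul (DoubleCentralizer.coeHom (𝕜 := ℂ) (A := A)) a b

theorem coe_multiplier_sub (a b : A) :
    ((a - b : A) : 𝓜(ℂ, A)) = (a : 𝓜(ℂ, A)) - (b : 𝓜(ℂ, A)) :=
  map_sub (DoubleCentralizer.coeHom (𝕜 := ℂ) (A := A)) a b

theorem coe_multiplier_injective : Function.Injective fun a : A => (a : 𝓜(ℂ, A)) := by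
  intro a b h
  have h1 : ‖((a - b : A) : 𝓜(ℂ, A))‖ = 0 := by
    rw [coe_multiplier_sub, norm_eq_zero]
    exact sub_eq_zero.2 h
  rwa [norm_coe_multiplier, norm_eq_zero, sub_eq_zero] at h1

/-- `u.fst a` is the product of `u` and `a` in the multiplier algebra. -/
theorem coe_fst_apply (u : 𝓜(ℂ, A)) (a : A) :
    ((u.fst a : A) : 𝓜(ℂ, A)) = u * (a : 𝓜(ℂ, A)) := by
  refine DoubleCentralizer.ext ℂ A _ _ (Prod.ext ?_ ?_)
  · ext b
    have key : ∀ c, c * u.fst (a * b) = c * (u.fst a * b) := fun c => by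
      rw [← u.central, ← mul_assoc, u.central, mul_assoc]
    have h : u.fst (a * b) - u.fst a * b = 0 := by
      apply CStarRing.star_mul_self_eq_zero_iff _ |>.1
      rw [mul_sub, key, sub_self]
    simpa using (sub_eq_zero.1 h).symm
  · ext b
    simp [u.central]

theorem norm_mulMultiplier (a : A) (u : unitary 𝓜(ℂ, A)) :
    ‖mulMultiplier a (u : 𝓜(ℂ, A))‖ = ‖a‖ := by
  rw [← norm_coe_multiplier, coe_mulMultiplier, CStarRing.norm_mul_coe_unitary,
    norm_coe_multiplier]

theorem norm_fst_unitary_apply (u : unitary 𝓜(ℂ, A)) (a : A) :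
    ‖(u : 𝓜(ℂ, A)).fst a‖ = ‖a‖ := by
  rw [← norm_coe_multiplier, coe_fst_apply, CStarRing.norm_coe_unitary_mul, norm_coe_multiplier]

theorem mulMultiplier_mulMultiplier (a : A) (u v : 𝓜(ℂ, A)) :
    mulMultiplier (mulMultiplier a u) v = mulMultiplier a (u * v) := by
  apply coe_multiplier_injective
  simp only [coe_mulMultiplier, mul_assoc]

theorem mulMultiplier_one (a : A) : mulMultiplier a (1 : 𝓜(ℂ, A)) = a := by
  apply coe_multiplier_injective
  simp only [coe_mulMultiplier, mul_one]

theorem fst_mul (a b : A) (u : 𝓜(ℂ, A)) : u.fst (a * b) = u.fst a * b := by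
  apply coe_multiplier_injective
  simp only [coe_multiplier_mul, coe_fst_apply, mul_assoc]

theorem mulMultiplier_add (a b : A) (u : 𝓜(ℂ, A)) :
    mulMultiplier (a + b) u = mulMultiplier a u + mulMultiplier b u := map_add u.snd a b

theorem mulMultiplier_smul (c : ℂ) (a : A) (u : 𝓜(ℂ, A)) :
    mulMultiplier (c • a) u = c • mulMultiplier a u := map_smul u.snd c a

theorem mulMultiplier_sub (a b : A) (u : 𝓜(ℂ, A)) :
    mulMultiplier (a - b) u = mulMultiplier a u - mulMultiplier b u := map_sub u.snd a b

theorem mulMultiplier_zero (u : 𝓜(ℂ, A)) : mulMultiplier (0 : A) u = 0 := map_zero u.snd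

theorem StarAlgEquiv.norm_apply (φ : A ≃⋆ₐ[ℂ] A) (a : A) : ‖φ a‖ = ‖a‖ :=
  (NonUnitalStarAlgHom.isometry φ (EquivLike.injective φ)).norm_map_of_map_zero (map_zero φ) a

theorem StarAlgEquiv.apply_mulMultiplier (φ : A ≃⋆ₐ[ℂ] A) (a : A) (u : 𝓜(ℂ, A)) :
    φ (mulMultiplier a u) = mulMultiplier (φ a) (φ.extendMultiplier u) := by
  simp [mulMultiplier, StarAlgEquiv.extendMultiplier, StarAlgEquiv.toBounded]

end Multipliers

/-! ### Twisted translations -/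

section Translations

variable {G : Type*} [Group G] [TopologicalSpace G] {A : Type*} [NonUnitalCStarAlgebra A]
  (T : TwistedAction G A)

/-- The twisted left translation `(S_x Ψ)(z) = α_x(Ψ(x⁻¹z)) ω(x, x⁻¹z)`. -/
def TwistedAction.shift (x : G) (Ψ : G → A) (z : G) : A :=
  mulMultiplier (T.α x (Ψ (x⁻¹ * z))) (T.ω x (x⁻¹ * z) : 𝓜(ℂ, A))

theorem TwistedAction.norm_shift (x : G) (Ψ : G → A) (z : G) :
    ‖T.shift x Ψ z‖ = ‖Ψ (x⁻¹ * z)‖ := by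
  rw [TwistedAction.shift, norm_mulMultiplier, StarAlgEquiv.norm_apply]

theorem TwistedAction.shift_one (Ψ : G → A) : T.shift 1 Ψ = Ψ := by
  funext z
  simp [TwistedAction.shift, T.α_one, T.ω_one_left, mulMultiplier_one]

theorem TwistedAction.shift_add (x : G) (Φ Ψ : G → A) :
    T.shift x (Φ + Ψ) = T.shift x Φ + T.shift x Ψ := by
  funext z
  simp [TwistedAction.shift, mulMultiplier_add]

theorem TwistedAction.shift_smul (x : G) (c : ℂ) (Ψ : G → A) :
    T.shift x (c • Ψ) = c • T.shift x Ψ := by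
  funext z
  simp [TwistedAction.shift, mulMultiplier_smul]

/-- The operation `Ψ ↦ m S_x Ψ` for a multiplier `m`. -/
def TwistedAction.translate (m : 𝓜(ℂ, A)) (x : G) (Ψ : G → A) (z : G) : A :=
  m.fst (T.shift x Ψ z)

/-- The inverse of `TwistedAction.translate` for a unitary multiplier. -/
def TwistedAction.untranslate (u : unitary 𝓜(ℂ, A)) (x : G) (Ψ : G → A) (z : G) : A :=
  (T.α x).symm (mulMultiplier (((star u : unitary 𝓜(ℂ, A)) : 𝓜(ℂ, A)).fst (Ψ (x * z)))
    ((star (T.ω x z) : unitary 𝓜(ℂ, A)) : 𝓜(ℂ, A)))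

theorem TwistedAction.untranslate_translate (u : unitary 𝓜(ℂ, A)) (x : G) (Ψ : G → A) :
    T.untranslate u x (T.translate u x Ψ) = Ψ := by
  funext z
  have h1 : ((star u : unitary 𝓜(ℂ, A)) : 𝓜(ℂ, A)).fst
      ((u : 𝓜(ℂ, A)).fst (T.shift x Ψ (x * z))) = T.shift x Ψ (x * z) := by
    apply coe_multiplier_injective
    simp only [coe_fst_apply]
    rw [← mul_assoc, Unitary.coe_star, Unitary.star_mul_self_of_mem u.2, one_mul]
  rw [TwistedAction.untranslate, TwistedAction.translate, h1, TwistedAction.shift,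
    inv_mul_cancel_left, mulMultiplier_mulMultiplier, Unitary.coe_star,
    Unitary.mul_star_self_of_mem (T.ω x z).2, mulMultiplier_one, StarAlgEquiv.symm_apply_apply]

theorem TwistedAction.translate_untranslate (u : unitary 𝓜(ℂ, A)) (x : G) (Ψ : G → A) :
    T.translate u x (T.untranslate u x Ψ) = Ψ := by
  funext z
  rw [TwistedAction.translate, TwistedAction.shift, TwistedAction.untranslate,
    mul_inv_cancel_left, StarAlgEquiv.apply_symm_apply, mulMultiplier_mulMultiplier,
    Unitary.coe_star (U := T.ω _ _), Unitary.star_mul_self_of_mem (T.ω _ _).2, mulMultiplier_one]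
  apply coe_multiplier_injective
  simp only [coe_fst_apply]
  rw [← mul_assoc, Unitary.coe_star, Unitary.mul_star_self_of_mem u.2, one_mul]

theorem TwistedAction.norm_translate (u : unitary 𝓜(ℂ, A)) (x : G) (Ψ : G → A) (z : G) :
    ‖T.translate u x Ψ z‖ = ‖Ψ (x⁻¹ * z)‖ := by
  rw [TwistedAction.translate, norm_fst_unitary_apply, T.norm_shift]

/-- The cocycle identity for twisted translations. -/
theorem TwistedAction.shift_mul_shift (x y z : G) (a : A) (Ψ : G → A) :
    mulMultiplier (T.α x (a * T.shift y Ψ (x⁻¹ * z))) (T.ω x (x⁻¹ * z) : 𝓜(ℂ, A)) =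
      mulMultiplier (T.α x a) (T.ω x y : 𝓜(ℂ, A)) * T.shift (x * y) Ψ z := by
  have hc := T.cocycle x y (y⁻¹ * (x⁻¹ * z))
  rw [mul_inv_cancel_left] at hc
  have ht := T.twist x y (Ψ (y⁻¹ * (x⁻¹ * z)))
  have hg : (x * y)⁻¹ * z = y⁻¹ * (x⁻¹ * z) := by group
  rw [TwistedAction.shift, TwistedAction.shift, hg, map_mul, StarAlgEquiv.apply_mulMultiplier]
  apply coe_multiplier_injective
  simp only [coe_multiplier_mul, coe_mulMultiplier]
  rw [mul_assoc, mul_assoc, hc, ← mul_assoc ((T.α x (T.α y _) : A) : 𝓜(ℂ, A)), ht]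
  simp only [mul_assoc]

/-- Strong continuity in the group variables becomes joint continuity because each α x and each
multiplication by ω x y is isometric. -/
theorem TwistedAction.continuous_act :
    Continuous fun p : A × (G × G) => mulMultiplier (T.α p.2.1 p.1) (T.ω p.2.1 p.2.2 : 𝓜(ℂ, A)) := by
  have h1 : Continuous fun p : A × G => T.α p.2 p.1 :=
    continuous_prod_of_continuous_lipschitzWith _ 1 (fun a => T.continuous_α a) fun x =>
      LipschitzWith.of_dist_le_mul fun a b => by
        simp only [dist_eq_norm, ← map_sub, StarAlgEquiv.norm_apply]
        simp
  have h2 : Continuous fun p : A × (G × G) => mulMultiplier p.1 (T.ω p.2.1 p.2.2 : 𝓜(ℂ, A)) :=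
    continuous_prod_of_continuous_lipschitzWith _ 1 (fun a => T.continuous_ω_right a) fun x =>
      LipschitzWith.of_dist_le_mul fun a b => by
        simp only [dist_eq_norm, ← mulMultiplier_sub, norm_mulMultiplier]
        simp
  exact h2.comp ((h1.comp (continuous_fst.prodMk (continuous_fst.comp continuous_snd))).prodMk
    continuous_snd)

/-- As α x is isometric, ‖(α x)⁻¹ a - (α x₀)⁻¹ a‖ = ‖a - α x ((α x₀)⁻¹ a)‖, which reduces continuity
of the inverses to that of α. -/
theorem TwistedAction.continuous_α_symm {Ψ : G → A} (hΨ : Continuous Ψ) :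
    Continuous fun x => (T.α x).symm (Ψ x) := by
  have h : ∀ a, Continuous fun x => (T.α x).symm a := fun a => by
    refine continuous_iff_continuousAt.2 fun x₀ => ?_
    refine tendsto_iff_norm_sub_tendsto_zero.2 ?_
    have h1 : ∀ x, ‖(T.α x).symm a - (T.α x₀).symm a‖ = ‖a - T.α x ((T.α x₀).symm a)‖ :=
      fun x => by
        rw [← StarAlgEquiv.norm_apply (T.α x), map_sub, StarAlgEquiv.apply_symm_apply]
    simp only [h1]
    have h2 := ((continuous_const (y := a)).sub (T.continuous_α ((T.α x₀).symm a))).norm.tendsto x₀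
    simpa using h2
  have h3 : Continuous fun p : A × G => (T.α p.2).symm p.1 :=
    continuous_prod_of_continuous_lipschitzWith _ 1 h fun x =>
      LipschitzWith.of_dist_le_mul fun a b => by
        simp only [dist_eq_norm, ← map_sub, StarAlgEquiv.norm_apply]
        simp
  exact h3.comp (hΨ.prodMk continuous_id)

variable [IsTopologicalGroup G]

theorem TwistedAction.continuous_shift {Ψ : G → A} (hΨ : Continuous Ψ) :
    Continuous fun p : G × G => T.shift p.1 Ψ p.2 := by
  have h : Continuous fun p : G × G => p.1⁻¹ * p.2 := by fun_prop
  exact T.continuous_act.comp ((hΨ.comp h).prodMk (continuous_fst.prodMk h))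

theorem TwistedAction.continuous_translate (m : 𝓜(ℂ, A)) (x : G) {Ψ : G → A}
    (hΨ : Continuous Ψ) : Continuous (T.translate m x Ψ) :=
  m.fst.continuous.comp ((T.continuous_shift hΨ).comp (Continuous.prodMk_right x))

theorem TwistedAction.continuous_untranslate (u : unitary 𝓜(ℂ, A)) (x : G) {Ψ : G → A}
    (hΨ : Continuous Ψ) : Continuous (T.untranslate u x Ψ) := by
  have h2 : Continuous fun p : A × G =>
      mulMultiplier p.1 ((star (T.ω x p.2) : unitary 𝓜(ℂ, A)) : 𝓜(ℂ, A)) :=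
    continuous_prod_of_continuous_lipschitzWith _ 1 (fun a => by
        -- From a ω* = (ω a*)*, strict continuity of ω on the left controls right multiplication by
        -- its adjoint.
        have h3 : ∀ z, mulMultiplier a ((star (T.ω x z) : unitary 𝓜(ℂ, A)) : 𝓜(ℂ, A)) =
            star ((T.ω x z : 𝓜(ℂ, A)).fst (star a)) := fun z => by
          rw [mulMultiplier, Unitary.coe_star, DoubleCentralizer.star_snd]
        simp only [h3]
        exact ((T.continuous_ω_left (star a)).comp (Continuous.prodMk_right x)).star) fun x =>
      LipschitzWith.of_dist_le_mul fun a b => by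
        simp only [dist_eq_norm, ← mulMultiplier_sub, norm_mulMultiplier]
        simp
  have h3 : Continuous fun z => ((star u : unitary 𝓜(ℂ, A)) : 𝓜(ℂ, A)).fst (Ψ (x * z)) :=
    (ContinuousLinearMap.continuous _).comp (hΨ.comp (continuous_const_mul x))
  have h4 := h2.comp (h3.prodMk continuous_id)
  have h5 : Isometry (T.α x).symm :=
    NonUnitalStarAlgHom.isometry (T.α x).symm (EquivLike.injective (T.α x).symm)
  exact h5.continuous.comp h4

end Translations

/-! ### Compactly supported functions -/

section CompactlySupported

variable {G : Type*} [Group G] [TopologicalSpace G] {A : Type*} [NonUnitalCStarAlgebra A]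

/-- The continuous compactly supported functions that vanish outside of the subgroup `H`. -/
def CcOn (H : Subgroup G) (A : Type*) [NonUnitalCStarAlgebra A] : Submodule ℂ (G → A) where
  carrier := {f | Continuous f ∧ HasCompactSupport f ∧ ∀ x ∉ H, f x = 0}
  zero_mem' := ⟨continuous_zero, HasCompactSupport.zero, fun _ _ => rfl⟩
  add_mem' := fun {f g} hf hg => ⟨hf.1.add hg.1, hf.2.1.add hg.2.1, fun x hx => by
    rw [Pi.add_apply, hf.2.2 x hx, hg.2.2 x hx, add_zero]⟩
  smul_mem' := fun c f hf => ⟨hf.1.const_smul c, hf.2.1.smul_left (f := fun _ => c), fun x hx => by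
    rw [Pi.smul_apply, hf.2.2 x hx, smul_zero]⟩

theorem CcOn.mono {H H' : Subgroup G} (h : H ≤ H') : CcOn H A ≤ CcOn H' A := fun _ hf =>
  ⟨hf.1, hf.2.1, fun x hx => hf.2.2 x fun hx' => hx (h hx')⟩

variable (T : TwistedAction G A)

theorem TwistedAction.shift_eq_zero {x z : G} {Ψ : G → A} (h : Ψ (x⁻¹ * z) = 0) :
    T.shift x Ψ z = 0 := by
  rw [TwistedAction.shift, h, map_zero, mulMultiplier_zero]

section

variable [IsTopologicalGroup G]

theorem TwistedAction.continuous_conv_integrand {Φ Ψ : G → A} (hΦ : Continuous Φ)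
    (hΨ : Continuous Ψ) : Continuous fun p : G × G => Φ p.2 * T.shift p.2 Ψ p.1 :=
  (hΦ.comp continuous_snd).mul
    ((T.continuous_shift hΨ).comp (continuous_snd.prodMk continuous_fst))

theorem TwistedAction.translate_mem_ccOn {H : Subgroup G} (m : 𝓜(ℂ, A)) {x : G} (hx : x ∈ H)
    (Ψ : CcOn H A) : T.translate m x Ψ ∈ CcOn H A := by
  have h0 : ∀ z, (Ψ : G → A) (x⁻¹ * z) = 0 → T.translate m x Ψ z = 0 := fun z hz => by
    rw [TwistedAction.translate, T.shift_eq_zero hz, map_zero]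
  refine ⟨T.continuous_translate m x Ψ.2.1, ?_, fun z hz => ?_⟩
  · refine HasCompactSupport.intro
      ((Ψ.2.2.1 : IsCompact _).image (continuous_const_mul x)) fun z hz => h0 z ?_
    exact image_eq_zero_of_notMem_tsupport fun h => hz ⟨x⁻¹ * z, h, by simp⟩
  · exact h0 z (Ψ.2.2.2 _ fun h => hz ((H.mul_mem_cancel_left (H.inv_mem hx)).1 h))

end

variable [MeasurableSpace G] [BorelSpace G] (μ : Measure G)
  [IsFiniteMeasureOnCompacts μ]

theorem CcOn.integrable {H : Subgroup G} (f : CcOn H A) : Integrable (f : G → A) μ :=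
  f.2.1.integrable_of_hasCompactSupport f.2.2.1

/-- The class in `L¹_{α,ω}(G, A)` of a continuous compactly supported function. -/
def TwistedL1.ofCc (H : Subgroup G) : CcOn H A →ₗ[ℂ] TwistedL1 T μ where
  toFun f := ((CcOn.integrable μ f).toL1 f : Lp A 1 μ)
  map_add' f g := Integrable.toL1_add _ _ (CcOn.integrable μ f) (CcOn.integrable μ g)
  map_smul' c f := Integrable.toL1_smul' _ (CcOn.integrable μ f) c

theorem TwistedL1.norm_ofCc {H : Subgroup G} (f : CcOn H A) :
    ‖TwistedL1.ofCc T μ H f‖ = ∫ x, ‖(f : G → A) x‖ ∂μ :=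
  L1.norm_of_fun_eq_integral_norm (CcOn.integrable μ f)

theorem TwistedL1.rep_ofCc {H : Subgroup G} (f : CcOn H A) :
    (TwistedL1.ofCc T μ H f).rep =ᵐ[μ] (f : G → A) :=
  Integrable.coeFn_toL1 (CcOn.integrable μ f)

theorem TwistedL1.ofCc_mem_ofSubgroup {H : Subgroup G} (f : CcOn H A) :
    TwistedL1.ofCc T μ H f ∈ TwistedL1.ofSubgroup T μ H := by
  change ∀ᵐ x ∂μ, x ∉ H → (TwistedL1.ofCc T μ H f).rep x = 0
  filter_upwards [TwistedL1.rep_ofCc T μ f] with x hx hxH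
  rw [hx, f.2.2.2 x hxH]

/-- A pointwise bound on a compact set gives a bound of the `L¹`-norm. -/
theorem TwistedL1.norm_ofCc_le {H : Subgroup G} (f : CcOn H A) {K : Set G} (hK : IsCompact K)
    {ε : ℝ} (hf : ∀ x ∈ K, ‖(f : G → A) x‖ ≤ ε) (hf' : ∀ x ∉ K, (f : G → A) x = 0) :
    ‖TwistedL1.ofCc T μ H f‖ ≤ ε * μ.real K := by
  rw [TwistedL1.norm_ofCc, ← setIntegral_eq_integral_of_forall_compl_eq_zero (s := K)
    fun x hx => by rw [hf' x hx, norm_zero]]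
  exact (le_abs_self _).trans (norm_setIntegral_le_of_norm_le_const
    (f := fun x => ‖(f : G → A) x‖) hK.measure_lt_top fun x hx => by simpa using hf x hx)

variable [IsTopologicalGroup G]

theorem TwistedAction.integrable_conv_integrand {Φ Ψ : G → A} (hΦ : Continuous Φ)
    (hΦc : HasCompactSupport Φ) (hΨ : Continuous Ψ) (x : G) :
    Integrable (fun y => Φ y * T.shift y Ψ x) μ :=
  ((T.continuous_conv_integrand hΦ hΨ).comp
    (Continuous.prodMk_right x)).integrable_of_hasCompactSupport hΦc.mul_right

theorem TwistedAction.conv_mem_ccOn {H : Subgroup G} (Φ Ψ : CcOn H A) :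
    T.conv μ Φ Ψ ∈ CcOn H A := by
  refine ⟨?_, ?_, fun x hx => ?_⟩
  · have h := continuousOn_integral_of_compact_support (μ := μ) (s := Set.univ)
      (k := tsupport (Φ : G → A)) (f := fun x y => (Φ : G → A) y * T.shift y Ψ x) Φ.2.2.1
      (T.continuous_conv_integrand Φ.2.1 Ψ.2.1).continuousOn
      fun x y _ hy => by rw [image_eq_zero_of_notMem_tsupport hy, zero_mul]
    exact continuousOn_univ.1 h
  · refine HasCompactSupport.intro
      (((Φ.2.2.1 : IsCompact _).prod (Ψ.2.2.1 : IsCompact _)).image continuous_mul) fun x hx => ?_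
    refine integral_eq_zero_of_ae (Eventually.of_forall fun y => ?_)
    change (Φ : G → A) y * T.shift y Ψ x = 0
    by_cases hy : y ∈ tsupport (Φ : G → A)
    · rw [T.shift_eq_zero, mul_zero]
      refine image_eq_zero_of_notMem_tsupport fun hy' => hx ⟨(y, y⁻¹ * x), ⟨hy, hy'⟩, ?_⟩
      simp
    · rw [image_eq_zero_of_notMem_tsupport hy, zero_mul]
  · refine integral_eq_zero_of_ae (Eventually.of_forall fun y => ?_)
    change (Φ : G → A) y * T.shift y Ψ x = 0
    by_cases hy : y ∈ H
    · rw [T.shift_eq_zero, mul_zero]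
      exact Ψ.2.2.2 _ fun h => hx ((H.mul_mem_cancel_left (H.inv_mem hy)).1 h)
    · rw [Φ.2.2.2 y hy, zero_mul]

/-- The twisted convolution of continuous compactly supported functions. -/
def TwistedAction.convCc {H : Subgroup G} (Φ Ψ : CcOn H A) : CcOn H A :=
  ⟨T.conv μ Φ Ψ, T.conv_mem_ccOn μ Φ Ψ⟩

/-- Twisted translations are left centralizers of the twisted convolution. -/
theorem TwistedAction.translate_conv [μ.IsMulLeftInvariant] (m : 𝓜(ℂ, A)) (x : G) {Φ Ψ : G → A}
    (hΦ : Continuous Φ) (hΦc : HasCompactSupport Φ) (hΨ : Continuous Ψ) :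
    T.translate m x (T.conv μ Φ Ψ) = T.conv μ (T.translate m x Φ) Ψ := by
  funext z
  -- C a = m α_x(a) ω(x, x⁻¹z) is bounded, so it passes under the integral. The substitution y ↦ x y
  -- and the cocycle identity do the rest.
  let C : A →L[ℂ] A := m.fst ∘L (T.ω x (x⁻¹ * z) : 𝓜(ℂ, A)).snd ∘L (T.α x).toBounded
  have hC : ∀ a, C a = m.fst (mulMultiplier (T.α x a) (T.ω x (x⁻¹ * z) : 𝓜(ℂ, A))) := fun a => rfl
  have h1 : T.translate m x (T.conv μ Φ Ψ) z = C (∫ y, Φ y * T.shift y Ψ (x⁻¹ * z) ∂μ) := rfl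
  have h2 : T.conv μ (T.translate m x Φ) Ψ z =
      ∫ y, T.translate m x Φ (x * y) * T.shift (x * y) Ψ z ∂μ :=
    (integral_mul_left_eq_self (μ := μ) (fun y => T.translate m x Φ y * T.shift y Ψ z) x).symm
  rw [h1, h2, ← C.integral_comp_comm (T.integrable_conv_integrand μ hΦ hΦc hΨ _)]
  refine integral_congr_ae (Eventually.of_forall fun y => ?_)
  simp only [hC]
  rw [T.shift_mul_shift, fst_mul, TwistedAction.translate]
  nth_rw 2 [TwistedAction.shift]
  rw [inv_mul_cancel_left]

/-- For a unitary multiplier `u` and `x ∈ H`, the twisted translation as an automorphism of the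
space of compactly supported functions. -/
def TwistedAction.translateEquiv {H : Subgroup G} (u : unitary 𝓜(ℂ, A)) {x : G} (hx : x ∈ H) :
    CcOn H A ≃ₗ[ℂ] CcOn H A where
  toFun Ψ := ⟨T.translate u x Ψ, T.translate_mem_ccOn u hx Ψ⟩
  map_add' Φ Ψ := Subtype.ext (by
    funext z
    simp [TwistedAction.translate, T.shift_add])
  map_smul' c Ψ := Subtype.ext (by
    funext z
    simp [TwistedAction.translate, T.shift_smul])
  invFun Ψ := ⟨T.untranslate u x Ψ, T.continuous_untranslate u x Ψ.2.1, by
    have h0 : ∀ z, (Ψ : G → A) (x * z) = 0 → T.untranslate u x Ψ z = 0 := fun z hz => by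
      rw [TwistedAction.untranslate, hz, map_zero, mulMultiplier_zero, map_zero]
    refine ⟨HasCompactSupport.intro
      ((Ψ.2.2.1 : IsCompact _).image (continuous_const_mul x⁻¹)) fun z hz => h0 z ?_, fun z hz => ?_⟩
    · exact image_eq_zero_of_notMem_tsupport fun h => hz ⟨x * z, h, by simp⟩
    · exact h0 z (Ψ.2.2.2 _ fun h => hz ((H.mul_mem_cancel_left hx).1 h))⟩
  left_inv Ψ := Subtype.ext (T.untranslate_translate u x Ψ)
  right_inv Ψ := Subtype.ext (T.translate_untranslate u x Ψ)

theorem TwistedAction.norm_ofCc_translateEquiv [μ.IsMulLeftInvariant] {H : Subgroup G}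
    (u : unitary 𝓜(ℂ, A)) {x : G} (hx : x ∈ H) (Ψ : CcOn H A) :
    ‖TwistedL1.ofCc T μ H (T.translateEquiv u hx Ψ)‖ = ‖TwistedL1.ofCc T μ H Ψ‖ := by
  rw [TwistedL1.norm_ofCc, TwistedL1.norm_ofCc, ← integral_mul_left_eq_self (μ := μ)
    (fun z => ‖(Ψ : G → A) z‖) x⁻¹]
  exact integral_congr_ae (Eventually.of_forall fun z => T.norm_translate u x Ψ z)

theorem TwistedAction.translateEquiv_convCc [μ.IsMulLeftInvariant] {H : Subgroup G}
    (u : unitary 𝓜(ℂ, A)) {x : G} (hx : x ∈ H) (Φ Ψ : CcOn H A) :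
    T.translateEquiv u hx (T.convCc μ Φ Ψ) = T.convCc μ (T.translateEquiv u hx Φ) Ψ :=
  Subtype.ext (T.translate_conv μ u x Φ.2.1 Φ.2.2.1 Ψ.2.1)

/-- Extension by zero of continuous functions on a compact set, as a bounded map to `L¹`. -/
theorem exists_extendL1 (K : Set G) (hK : IsCompact K) (hKm : MeasurableSet K) :
    ∃ j : C(K, A) →L[ℂ] TwistedL1 T μ, ∀ (f : C(K, A)) (g : CcOn (⊤ : Subgroup G) A),
      (∀ x : K, f x = (g : G → A) x) → (∀ x ∉ K, (g : G → A) x = 0) →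
      j f = TwistedL1.ofCc T μ ⊤ g := by
  have : CompactSpace K := isCompact_iff_compactSpace.1 hK
  let ext : C(K, A) → G → A := fun f => Function.extend Subtype.val (f : K → A) (0 : G → A)
  have hext : ∀ f (x : K), ext f x = f x := fun f x => Subtype.val_injective.extend_apply f 0 x
  have hext' : ∀ f, ∀ x ∉ K, ext f x = 0 := fun f x hx =>
    Function.extend_apply' (f : K → A) (0 : G → A) x fun ⟨y, hy⟩ => hx (hy ▸ y.2)
  have hbound : ∀ f x, ‖ext f x‖ ≤ K.indicator (fun _ => ‖f‖) x := fun f x => by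
    by_cases hx : x ∈ K
    · rw [Set.indicator_of_mem hx, hext f ⟨x, hx⟩]
      exact f.norm_coe_le_norm _
    · rw [Set.indicator_of_notMem hx, hext' f x hx, norm_zero]
  have hind : ∀ c : ℝ, Integrable (K.indicator fun _ => c) μ := fun c =>
    (integrable_indicator_iff hKm).2 (integrableOn_const hK.measure_lt_top.ne)
  have hint : ∀ f, Integrable (ext f) μ := fun f => by
    have hsm : StronglyMeasurable f :=
      f.continuous.stronglyMeasurable_of_hasCompactSupport (HasCompactSupport.of_compactSpace f)
    exact (hind ‖f‖).mono' ((MeasurableEmbedding.subtype_coe hKm).stronglyMeasurable_extend hsm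
      stronglyMeasurable_zero).aestronglyMeasurable (Eventually.of_forall (hbound f))
  let j₀ : C(K, A) →ₗ[ℂ] TwistedL1 T μ :=
    { toFun := fun f => ((hint f).toL1 (ext f) : Lp A 1 μ)
      map_add' := fun f g => by
        refine Eq.trans ?_ (Integrable.toL1_add _ _ (hint f) (hint g))
        congr 1
        funext x
        by_cases hx : x ∈ K
        · simp [hext _ ⟨x, hx⟩]
        · simp [hext' _ x hx]
      map_smul' := fun c f => by
        refine Eq.trans ?_ (Integrable.toL1_smul' _ (hint f) c)
        congr 1
        funext x
        by_cases hx : x ∈ K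
        · simp [hext _ ⟨x, hx⟩]
        · simp [hext' _ x hx] }
  refine ⟨j₀.mkContinuous (μ.real K) fun f => ?_, fun f g h1 h2 => ?_⟩
  · have h3 : ‖j₀ f‖ = ∫ x, ‖ext f x‖ ∂μ := L1.norm_of_fun_eq_integral_norm (hint f)
    rw [h3]
    calc ∫ x, ‖ext f x‖ ∂μ ≤ ∫ x, K.indicator (fun _ => ‖f‖) x ∂μ :=
          integral_mono (hint f).norm (hind _) (hbound f)
      _ = μ.real K * ‖f‖ := by rw [integral_indicator hKm, setIntegral_const, smul_eq_mul]
  · have h3 : ext f = (g : G → A) := by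
      funext x
      by_cases hx : x ∈ K
      · rw [hext f ⟨x, hx⟩, h1]
      · rw [hext' f x hx, h2 x hx]
    change ((hint f).toL1 (ext f) : Lp A 1 μ) = (CcOn.integrable μ g).toL1 g
    congr 1

/-- The class of the twisted convolution is the integral of the classes of the twisted
translations. -/
theorem TwistedAction.mem_of_translate_mem [T2Space G] {H : Subgroup G} (Φ Ψ : CcOn H A)
    (M : Submodule ℂ (TwistedL1 T μ)) (hM : IsClosed (M : Set (TwistedL1 T μ)))
    (h : ∀ (a : A) (y : G) (hy : y ∈ H),
      TwistedL1.ofCc T μ H ⟨T.translate (a : 𝓜(ℂ, A)) y Ψ, T.translate_mem_ccOn _ hy Ψ⟩ ∈ M) :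
    TwistedL1.ofCc T μ H (T.convCc μ Φ Ψ) ∈ M := by
  obtain ⟨K, hK, hKdef⟩ : ∃ K : Set G, IsCompact K ∧ K = (fun p : G × G => p.1 * p.2) ''
      (tsupport (Φ : G → A) ×ˢ tsupport (Ψ : G → A)) :=
    ⟨_, ((Φ.2.2.1 : IsCompact _).prod (Ψ.2.2.1 : IsCompact _)).image continuous_mul, rfl⟩
  have hzero : ∀ y, ∀ x ∉ K, (Φ : G → A) y * T.shift y Ψ x = 0 := fun y x hx => by
    by_cases hy : y ∈ tsupport (Φ : G → A)
    · rw [T.shift_eq_zero, mul_zero]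
      refine image_eq_zero_of_notMem_tsupport fun hy' => hx ?_
      rw [hKdef]
      exact ⟨(y, y⁻¹ * x), ⟨hy, hy'⟩, by simp⟩
    · rw [image_eq_zero_of_notMem_tsupport hy, zero_mul]
  have : CompactSpace K := isCompact_iff_compactSpace.1 hK
  obtain ⟨j, hj⟩ := exists_extendL1 T μ K hK hK.isClosed.measurableSet
  -- Curried, y ↦ Φ(y) S_y Ψ is a continuous compactly supported map into the Banach space C(K, A).
  -- Its Bochner integral is the convolution on K, and `j` transports it to L¹.
  let g : C(G × K, A) := ⟨fun p => (Φ : G → A) p.1 * T.shift p.1 Ψ p.2,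
    (T.continuous_conv_integrand Φ.2.1 Ψ.2.1).comp
      ((continuous_subtype_val.comp continuous_snd).prodMk continuous_fst)⟩
  have hgi : Integrable (fun y => g.curry y) μ := by
    refine g.curry.continuous.integrable_of_hasCompactSupport ?_
    refine HasCompactSupport.intro (Φ.2.2.1 : IsCompact _) fun y hy => ?_
    ext x
    change (Φ : G → A) y * T.shift y Ψ x = 0
    rw [image_eq_zero_of_notMem_tsupport hy, zero_mul]
  have h1 : ∀ x : K, (∫ y, g.curry y ∂μ) x = T.conv μ Φ Ψ x := fun x =>
    ((ContinuousMap.evalCLM ℂ x).integral_comp_comm hgi).symm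
  have h2 : j (∫ y, g.curry y ∂μ) = TwistedL1.ofCc T μ H (T.convCc μ Φ Ψ) :=
    hj _ ⟨T.conv μ Φ Ψ, CcOn.mono le_top (T.conv_mem_ccOn μ Φ Ψ)⟩ h1 fun x hx =>
      integral_eq_zero_of_ae (Eventually.of_forall fun y => hzero y x hx)
  have h3 : ∀ y, j (g.curry y) ∈ M := fun y => by
    by_cases hy : y ∈ H
    · have h4 : j (g.curry y) = TwistedL1.ofCc T μ H
          ⟨T.translate ((Φ : G → A) y : 𝓜(ℂ, A)) y Ψ, T.translate_mem_ccOn _ hy Ψ⟩ :=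
        hj _ ⟨_, CcOn.mono le_top (T.translate_mem_ccOn ((Φ : G → A) y : 𝓜(ℂ, A)) hy Ψ)⟩
          (fun x => rfl) fun x hx => hzero y x hx
      rw [h4]
      exact h _ _ hy
    · have h4 : g.curry y = 0 := by
        ext x
        change (Φ : G → A) y * T.shift y Ψ x = 0
        rw [Φ.2.2.2 y hy, zero_mul]
      rw [h4, map_zero]
      exact M.zero_mem
  -- M is closed, so the integral can be computed in the quotient by M, where the integrand
  -- vanishes.
  rw [← h2, ← j.integral_comp_comm hgi, ← Submodule.Quotient.mk_eq_zero]
  have h5 := (M.mkQL).integral_comp_comm (j.integrable_comp hgi)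
  have h6 : ∀ y, M.mkQL (j (g.curry y)) = 0 := fun y => by simpa using h3 y
  simp only [h6, integral_zero] at h5
  simpa using h5.symm

end CompactlySupported

/-! ### Null sets and inversion -/

section Inversion

variable {G : Type*} [Group G] [TopologicalSpace G] [IsTopologicalGroup G] [LocallyCompactSpace G]
  [T2Space G] [MeasurableSpace G] [BorelSpace G] (μ : Measure G) [μ.IsHaarMeasure] [μ.Regular]

/-- On compactly supported functions, the inverse of a Haar measure has a continuous density. -/
theorem exists_continuous_density_inv :
    ∃ D : G → ℝ, Continuous D ∧ (∀ x, 0 < D x) ∧ ∀ f : G → ℝ, Continuous f → HasCompactSupport f →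
      ∫ x, f x ∂μ.inv = ∫ x, f x * D x ∂μ := by
  obtain ⟨⟨g, hg⟩, hgc, hg0, hg1⟩ := exists_continuous_nonneg_pos (1 : G)
  let c := ∫ x, g x ∂μ
  have hc : 0 < c := hg.integral_pos_of_hasCompactSupport_nonneg_nonzero hgc hg0 hg1
  let D : G → ℝ := fun y => ∫ z, g (z⁻¹ * y) ∂μ.inv
  have hD : Continuous D := continuous_integral_apply_inv_mul hg hgc
  have hDpos : ∀ y, 0 < D y := fun y => by
    have h1 : Continuous fun z => g (z⁻¹ * y) := by fun_prop
    refine h1.integral_pos_of_hasCompactSupport_nonneg_nonzero (x := y) ?_ (fun z => hg0 (z⁻¹ * y))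
      (by simpa using hg1)
    exact hgc.comp_homeomorph ((Homeomorph.inv G).trans (Homeomorph.mulRight y))
  refine ⟨fun y => D y / c, hD.div_const c, fun y => div_pos (hDpos y) hc, fun f hf hfc => ?_⟩
  -- The formula comparing left and right invariant measures contains the factor (D y)⁻¹; testing it
  -- on f * D cancels this factor.
  have h := Measure.integral_isMulLeftInvariant_isMulRightInvariant_combo (μ := μ) (ν := μ.inv)
    (hf.mul hD) hfc.mul_right hg hgc hg0 hg1
  have h2 : ∀ y, (f y * D y) * (∫ z, g (z⁻¹ * y) ∂μ.inv)⁻¹ = f y := fun y =>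
    mul_inv_cancel_right₀ (hDpos y).ne' (f y)
  simp only [Pi.mul_apply, h2] at h
  change _ = ∫ x, f x * (D x / c) ∂μ
  simp only [← mul_div_assoc, integral_div]
  rw [h, mul_div_cancel_right₀ _ hc.ne']

/-- Near a compact set the density of `μ.inv` is bounded, so `μ.inv` is at most a constant times `μ`
on open sets there. Outer regularity covers the null set by open sets of small measure. Working
inside a compact set avoids any σ-finiteness assumption on G. -/
theorem measure_inv_inter_eq_zero {N C : Set G} (hN : μ N = 0) (hC : IsCompact C) :
    μ (C ∩ N⁻¹) = 0 := by
  obtain ⟨D, hD, hDpos, hint⟩ := exists_continuous_density_inv μ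
  obtain ⟨C₀, hC₀, hCC₀⟩ := exists_compact_superset hC.inv
  obtain ⟨M, hM⟩ := (hC₀.image hD).bddAbove
  have hM' : ∀ x ∈ C₀, D x ≤ M := fun x hx => hM ⟨x, hx, rfl⟩
  have hset : μ (C ∩ N⁻¹) = μ.inv (N ∩ C⁻¹) := by
    rw [Measure.inv_apply, Set.inter_inv, inv_inv, Set.inter_comm]
  rw [hset]
  have hopen : ∀ O : Set G, IsOpen O → O ⊆ C₀ → μ.inv O ≤ ENNReal.ofReal (max M 0) * μ O := by
    intro O hO hOC
    have hOfin : μ O ≠ ⊤ := ((measure_mono hOC).trans_lt hC₀.measure_lt_top).ne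
    rw [hO.measure_eq_iSup_isCompact μ.inv]
    refine iSup₂_le fun K hKO => iSup_le fun hK => ?_
    obtain ⟨f, hf1, hf0, hfc, hf⟩ := exists_continuous_one_zero_of_isCompact hK hO.isClosed_compl
      (Set.disjoint_compl_right_iff_subset.2 hKO)
    have h1 : μ.inv.real K ≤ ∫ x, f x ∂μ.inv := by
      have h2 : μ.inv.real K = ∫ x, K.indicator (fun _ => (1 : ℝ)) x ∂μ.inv := by
        rw [integral_indicator hK.isClosed.measurableSet]
        simp
      rw [h2]
      refine integral_mono ((integrable_indicator_iff hK.isClosed.measurableSet).2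
        (integrableOn_const hK.measure_lt_top.ne)) (f.continuous.integrable_of_hasCompactSupport hfc)
        fun x => ?_
      by_cases hx : x ∈ K
      · simp [hx, hf1 hx]
      · simpa [hx] using (hf x).1
    have h3 : ∫ x, f x * D x ∂μ ≤ max M 0 * μ.real O := by
      have h4 : max M 0 * μ.real O = ∫ x, O.indicator (fun _ => max M 0) x ∂μ := by
        rw [integral_indicator hO.measurableSet]
        simp [mul_comm]
      rw [h4]
      refine integral_mono ((f.continuous.mul hD).integrable_of_hasCompactSupport hfc.mul_right)
        ((integrable_indicator_iff hO.measurableSet).2 (integrableOn_const hOfin)) fun x => ?_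
      by_cases hx : x ∈ O
      · simp only [Set.indicator_of_mem hx]
        calc f x * D x ≤ 1 * D x := mul_le_mul_of_nonneg_right (hf x).2 (hDpos x).le
          _ ≤ max M 0 := by rw [one_mul]; exact (hM' x (hOC hx)).trans (le_max_left _ _)
      · have : f x = 0 := hf0 hx
        simp [hx, this]
    rw [hint f f.continuous hfc] at h1
    rw [← ENNReal.ofReal_toReal hOfin, ← ENNReal.ofReal_mul (le_max_right _ _),
      ← ENNReal.ofReal_toReal hK.measure_lt_top.ne]
    exact ENNReal.ofReal_le_ofReal (h1.trans h3)
  refine nonpos_iff_eq_zero.1 (ENNReal.le_of_forall_pos_le_add fun δ hδ _ => ?_)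
  rw [zero_add]
  obtain ⟨k, hk⟩ : ∃ k : NNReal, ENNReal.ofReal (max M 0) = k := ⟨_, rfl⟩
  have hN' : μ (N ∩ C⁻¹) < ((δ / (k + 1) : NNReal) : ENNReal) := by
    rw [measure_mono_null Set.inter_subset_left hN]
    exact ENNReal.coe_pos.2 (by positivity)
  obtain ⟨O, hO, hOo, hOμ⟩ := (N ∩ C⁻¹).exists_isOpen_lt_of_lt _ hN'
  calc μ.inv (N ∩ C⁻¹) ≤ μ.inv (O ∩ interior C₀) :=
        measure_mono (Set.subset_inter hO (Set.inter_subset_right.trans hCC₀))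
    _ ≤ k * μ (O ∩ interior C₀) := by
        rw [← hk]
        exact hopen _ (hOo.inter isOpen_interior) (Set.inter_subset_right.trans interior_subset)
    _ ≤ k * ((δ / (k + 1) : NNReal) : ENNReal) := by
        gcongr
        exact (measure_mono Set.inter_subset_left).trans hOμ.le
    _ ≤ δ := by
        rw [← ENNReal.coe_mul]
        refine ENNReal.coe_le_coe.2 ?_
        rw [mul_div_assoc', div_le_iff₀ (by positivity), mul_comm]
        gcongr
        exact le_self_add

theorem measure_inv_mul_preimage_inter_eq_zero {N C : Set G} (hN : μ N = 0) (hC : IsCompact C)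
    (x : G) : μ (C ∩ {y | y⁻¹ * x ∈ N}) = 0 := by
  have h := measure_inv_inter_eq_zero μ hN (hC.image (continuous_const_mul x⁻¹))
  rw [← measure_preimage_mul μ x⁻¹] at h
  refine measure_mono_null (fun y hy => ?_) h
  refine ⟨⟨y, hy.1, rfl⟩, ?_⟩
  have h2 : y⁻¹ * x ∈ N := hy.2
  simpa using h2

end Inversion

/-! ### Products and density in `L¹` -/

section Products

variable {G : Type*} [Group G] [TopologicalSpace G] [IsTopologicalGroup G] [LocallyCompactSpace G]
  [T2Space G] [MeasurableSpace G] [BorelSpace G] {A : Type*} [NonUnitalCStarAlgebra A]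
  (T : TwistedAction G A) (μ : Measure G) [μ.IsHaarMeasure] [μ.Regular]

/-- Only y in the compact support of Φ contribute, and there a change of Ψ on a null set affects y ↦
Ψ (y⁻¹ x) only on a null set. The equality therefore holds at every point x. -/
theorem TwistedAction.conv_congr {Φ Φ' Ψ Ψ' : G → A} (hΦ : Φ' =ᵐ[μ] Φ) (hΨ : Ψ' =ᵐ[μ] Ψ)
    (hΦc : HasCompactSupport Φ) : T.conv μ Φ' Ψ' = T.conv μ Φ Ψ := by
  funext x
  refine integral_congr_ae ?_
  have h : ∀ᵐ y ∂μ, y ∈ tsupport Φ → Ψ' (y⁻¹ * x) = Ψ (y⁻¹ * x) := by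
    rw [ae_iff]
    refine measure_mono_null (fun y hy => ?_)
      (measure_inv_mul_preimage_inter_eq_zero μ (ae_iff.1 hΨ) hΦc x)
    simp only [Set.mem_ofPred_eq, Classical.not_imp] at hy
    exact hy
  filter_upwards [hΦ, h] with y h1 h2
  rw [h1]
  by_cases hy : y ∈ tsupport Φ
  · rw [h2 hy]
  · rw [image_eq_zero_of_notMem_tsupport hy, zero_mul, zero_mul]

/-- The product in L¹ is defined through arbitrary representatives. `TwistedAction.conv_congr`
replaces them by the continuous ones, whose convolution is integrable, so the default value 0 does
not intervene. -/
theorem TwistedL1.ofCc_mul_ofCc {H : Subgroup G} (Φ Ψ : CcOn H A) :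
    TwistedL1.ofCc T μ H Φ * TwistedL1.ofCc T μ H Ψ = TwistedL1.ofCc T μ H (T.convCc μ Φ Ψ) := by
  have h : T.conv μ (TwistedL1.ofCc T μ H Φ).rep (TwistedL1.ofCc T μ H Ψ).rep =
      T.conv μ Φ Ψ :=
    T.conv_congr μ (TwistedL1.rep_ofCc T μ Φ) (TwistedL1.rep_ofCc T μ Ψ) Φ.2.2.1
  have hi := CcOn.integrable μ (T.convCc μ Φ Ψ)
  have hi' : Integrable (T.conv μ (TwistedL1.ofCc T μ H Φ).rep (TwistedL1.ofCc T μ H Ψ).rep) μ := by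
    rw [h]
    exact hi
  refine (dif_pos hi').trans ?_
  change (hi'.toL1 _ : Lp A 1 μ) = hi.toL1 _
  exact (Integrable.toL1_eq_toL1_iff _ _ hi' hi).2 (Eventually.of_forall (congrFun h))

/-- In a locally compact Hausdorff space, indicators of sets of finite measure are approximated in
`L¹` by continuous functions with compact support. -/
theorem exists_continuous_approx_indicator {X E : Type*} [TopologicalSpace X] [T2Space X]
    [LocallyCompactSpace X] [MeasurableSpace X] [BorelSpace X] (μ : Measure X) [μ.Regular]
    [NormedAddCommGroup E] [NormedSpace ℝ E] (c : E) {s : Set X} (hs : MeasurableSet s)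
    (hμs : μ s < ⊤) {ε : ℝ} (hε : 0 < ε) :
    ∃ f : X → E, Continuous f ∧ HasCompactSupport f ∧
      ∫ x, ‖s.indicator (fun _ => c) x - f x‖ ∂μ < ε := by
  obtain ⟨η, hη, hηε⟩ : ∃ η : ℝ, 0 < η ∧ ‖c‖ * (η + η) < ε := by
    refine ⟨ε / (4 * (‖c‖ + 1)), by positivity, ?_⟩
    have : ‖c‖ * (ε / (4 * (‖c‖ + 1)) + ε / (4 * (‖c‖ + 1))) =
        (‖c‖ / (‖c‖ + 1)) * (ε / 2) := by field_simp; ring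
    rw [this]
    have h2 : ‖c‖ / (‖c‖ + 1) ≤ 1 := (div_le_one (by positivity)).2 (by linarith)
    nlinarith
  have hη' : ENNReal.ofReal η ≠ 0 := (ENNReal.ofReal_pos.2 hη).ne'
  -- K is an inner approximation of s and V an outer approximation of K; V need not contain s. A
  -- bump equal to 1 on K and 0 off V differs from the indicator only on s \ K and V \ K.
  obtain ⟨K, hKs, hK, hKc, hKμ⟩ := hs.exists_isCompact_isClosed_sdiff_lt hμs.ne hη'
  obtain ⟨V, hKV, hV, hVμ, hVKμ⟩ := hKc.measurableSet.exists_isOpen_sdiff_lt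
    (hK.measure_lt_top (μ := μ)).ne hη'
  obtain ⟨f, hf1, hf0, hfc, hf⟩ := exists_continuous_one_zero_of_isCompact hK hV.isClosed_compl
    (Set.disjoint_compl_right_iff_subset.2 hKV)
  have hm1 : MeasurableSet (s \ K) := hs.diff hKc.measurableSet
  have hm2 : MeasurableSet (V \ K) := hV.measurableSet.diff hKc.measurableSet
  have hi : ∀ {t : Set X}, MeasurableSet t → μ t < ENNReal.ofReal η →
      Integrable (t.indicator fun _ => ‖c‖) μ ∧ ∫ x, t.indicator (fun _ => ‖c‖) x ∂μ ≤ ‖c‖ * η := by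
    intro t ht htμ
    refine ⟨(integrable_indicator_iff ht).2 (integrableOn_const (htμ.trans_le le_top).ne), ?_⟩
    rw [integral_indicator ht, setIntegral_const, smul_eq_mul, mul_comm]
    gcongr
    exact ENNReal.toReal_le_of_le_ofReal hη.le htμ.le
  refine ⟨fun x => f x • c, f.continuous.smul continuous_const, hfc.smul_right, ?_⟩
  have hle : ∀ x, ‖s.indicator (fun _ => c) x - f x • c‖ ≤
      (s \ K).indicator (fun _ => ‖c‖) x + (V \ K).indicator (fun _ => ‖c‖) x := by
    intro x
    have h0 := (hf x).1
    have h1 := (hf x).2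
    have hc0 : ‖f x • c‖ ≤ ‖c‖ := by
      rw [norm_smul, Real.norm_of_nonneg h0]
      exact mul_le_of_le_one_left (norm_nonneg c) h1
    have hc1 : ‖c - f x • c‖ ≤ ‖c‖ := by
      have : c - f x • c = (1 - f x) • c := by rw [sub_smul, one_smul]
      rw [this, norm_smul, Real.norm_of_nonneg (by linarith)]
      exact mul_le_of_le_one_left (norm_nonneg c) (by linarith)
    by_cases hxK : x ∈ K
    · have : f x = 1 := hf1 hxK
      simp [hKs hxK, hxK, this]
    · by_cases hxs : x ∈ s
      · have h3 : 0 ≤ (V \ K).indicator (fun _ => ‖c‖) x :=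
          Set.indicator_nonneg (fun _ _ => norm_nonneg c) x
        rw [Set.indicator_of_mem hxs, Set.indicator_of_mem (show x ∈ s \ K from ⟨hxs, hxK⟩)]
        linarith
      · by_cases hxV : x ∈ V
        · simpa [hxs, hxV, hxK] using hc0
        · have : f x = 0 := hf0 hxV
          simp [hxs, hxV, this]
  calc ∫ x, ‖s.indicator (fun _ => c) x - f x • c‖ ∂μ
      ≤ ∫ x, ((s \ K).indicator (fun _ => ‖c‖) x + (V \ K).indicator (fun _ => ‖c‖) x) ∂μ := by
        refine integral_mono_of_nonneg (Eventually.of_forall fun _ => norm_nonneg _)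
          ((hi hm1 hKμ).1.add (hi hm2 hVKμ).1) (Eventually.of_forall hle)
    _ = ∫ x, (s \ K).indicator (fun _ => ‖c‖) x ∂μ + ∫ x, (V \ K).indicator (fun _ => ‖c‖) x ∂μ :=
        integral_add (hi hm1 hKμ).1 (hi hm2 hVKμ).1
    _ ≤ ‖c‖ * (η + η) := by
        rw [mul_add]
        exact add_le_add (hi hm1 hKμ).2 (hi hm2 hVKμ).2
    _ < ε := hηε

theorem TwistedL1.dense_range_ofCc :
    DenseRange (TwistedL1.ofCc T μ (⊤ : Subgroup G)) := by
  let M : Submodule ℂ (TwistedL1 T μ) :=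
    (LinearMap.range (TwistedL1.ofCc T μ (⊤ : Subgroup G))).topologicalClosure
  have hadd : ∀ f g : TwistedL1 T μ, f ∈ M → g ∈ M → f + g ∈ M := fun f g => M.add_mem
  have hcl : IsClosed (M : Set (TwistedL1 T μ)) := Submodule.isClosed_topologicalClosure _
  have hM : ∀ f : Lp A 1 μ, (show TwistedL1 T μ from f) ∈ M := by
    refine Lp.induction ENNReal.one_ne_top _ (fun c s hs hμs => ?_) (fun f g hf hg _ h1 h2 => ?_) ?_
    · have hi : Integrable (s.indicator fun _ => c) μ :=
        (integrable_indicator_iff hs).2 (integrableOn_const hμs.ne)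
      change (show TwistedL1 T μ from (hi.toL1 _ : Lp A 1 μ)) ∈ closure (Set.range _)
      rw [Metric.mem_closure_iff]
      intro ε hε
      obtain ⟨f, hf, hfc, hfε⟩ := exists_continuous_approx_indicator μ c hs hμs hε
      let F : CcOn (⊤ : Subgroup G) A := ⟨f, hf, hfc, fun x hx => absurd (Subgroup.mem_top x) hx⟩
      refine ⟨_, ⟨F, rfl⟩, ?_⟩
      have h1 : ‖(hi.sub (CcOn.integrable μ F)).toL1 _‖ < ε := by
        rw [L1.norm_of_fun_eq_integral_norm]
        exact hfε
      rw [Integrable.toL1_sub _ _ hi (CcOn.integrable μ F)] at h1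
      rw [dist_eq_norm]
      exact h1
    · exact hadd _ _ h1 h2
    · exact hcl
  exact fun f => hM f

end Products

/-! ### Approximate identities -/

section ApproximateIdentity

/-- A C*-algebra has norm-one approximate units for compact subsets. -/
theorem exists_approx_unit_of_isCompact {A : Type*} [NonUnitalCStarAlgebra A] {Z : Set A}
    (hZ : IsCompact Z) {ε : ℝ} (hε : 0 < ε) :
    ∃ b : A, ‖b‖ ≤ 1 ∧ ∀ z ∈ Z, ‖b * z - z‖ ≤ ε ∧ ‖z * b - z‖ ≤ ε := by
  let _ := CStarAlgebra.spectralOrder A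
  have := CStarAlgebra.spectralOrderedRing A
  have hl := CStarAlgebra.increasingApproximateUnit A
  have := hl.neBot
  obtain ⟨t, -, ht, hZt⟩ := hZ.finite_cover_balls (e := ε / 3) (by positivity)
  have h1 : ∀ᶠ b in CStarAlgebra.approximateUnit A, ∀ x ∈ t,
      ‖b * x - x‖ < ε / 3 ∧ ‖x * b - x‖ < ε / 3 := by
    refine (eventually_all_finite ht).2 fun x _ => ?_
    have h2 := Metric.tendsto_nhds.1 (hl.tendsto_mul_right x) (ε / 3) (by positivity)
    have h3 := Metric.tendsto_nhds.1 (hl.tendsto_mul_left x) (ε / 3) (by positivity)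
    filter_upwards [h2, h3] with b h2 h3
    exact ⟨by simpa [dist_eq_norm] using h2, by simpa [dist_eq_norm] using h3⟩
  obtain ⟨b, hb, hb1⟩ := (h1.and hl.eventually_norm).exists
  refine ⟨b, hb1, fun z hz => ?_⟩
  obtain ⟨x, hx, hzx⟩ := Set.mem_iUnion₂.1 (hZt hz)
  rw [Metric.mem_ball, dist_eq_norm] at hzx
  have hbz : ‖b * (z - x)‖ ≤ ‖z - x‖ :=
    (norm_mul_le _ _).trans (mul_le_of_le_one_left (norm_nonneg _) hb1)
  have hzb : ‖(z - x) * b‖ ≤ ‖z - x‖ :=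
    (norm_mul_le _ _).trans (mul_le_of_le_one_right (norm_nonneg _) hb1)
  constructor
  · have : b * z - z = b * (z - x) + (b * x - x) - (z - x) := by rw [mul_sub]; abel
    rw [this]
    refine (norm_sub_le _ _).trans ?_
    linarith [norm_add_le (b * (z - x)) (b * x - x), (hb x hx).1]
  · have : z * b - z = (z - x) * b + (x * b - x) - (z - x) := by rw [sub_mul]; abel
    rw [this]
    refine (norm_sub_le _ _).trans ?_
    linarith [norm_add_le ((z - x) * b) (x * b - x), (hb x hx).2]

variable {G : Type*} [Group G] [TopologicalSpace G] [IsTopologicalGroup G]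

/-- A continuous function of two variables that vanishes for `v = 1` is uniformly small for `v` near
`1` if its sections are supported in a common compact set. -/
theorem eventually_forall_norm_le {E : Type*} [NormedAddCommGroup E] {F : G → G → E}
    (hF : Continuous fun p : G × G => F p.1 p.2) (hF1 : ∀ x, F 1 x = 0) {C K : Set G}
    (hC : C ∈ 𝓝 (1 : G)) (hK : IsCompact K) (h0 : ∀ v ∈ C, ∀ x ∉ K, F v x = 0) {ε : ℝ}
    (hε : 0 < ε) : ∀ᶠ v in 𝓝 (1 : G), ∀ x, ‖F v x‖ ≤ ε := by
  have h1 : ∀ᶠ v in 𝓝 (1 : G), ∀ x ∈ K, ‖F v x‖ < ε := by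
    refine hK.eventually_forall_of_forall_eventually fun x _ => ?_
    have h2 := hF.norm.tendsto (1, x)
    simp only [hF1, norm_zero] at h2
    exact h2.eventually (gt_mem_nhds hε)
  filter_upwards [h1, hC] with v h1 hv x
  by_cases hx : x ∈ K
  · exact (h1 x hx).le
  · rw [h0 v hv x hx, norm_zero]
    exact hε.le

variable [LocallyCompactSpace G] [T2Space G] [MeasurableSpace G] [BorelSpace G]

/-- Symmetry turns φ (y⁻¹ x) into the left translate φ (x⁻¹ y), which still has integral 1 although
G need not be unimodular. This is what makes the approximate identity work on the right. -/
theorem exists_symmetric_bump (μ : Measure G) [μ.IsHaarMeasure] {V : Set G} (hV : IsOpen V)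
    (h1V : (1 : G) ∈ V) :
    ∃ φ : G → ℝ, Continuous φ ∧ HasCompactSupport φ ∧ (∀ x, 0 ≤ φ x) ∧ (∀ x, φ x⁻¹ = φ x) ∧
      (∀ x ∉ V, φ x = 0) ∧ ∫ x, φ x ∂μ = 1 := by
  obtain ⟨f, hf1, hf0, hfc, hf⟩ := exists_continuous_one_zero_of_isCompact
    (isCompact_singleton (x := (1 : G))) (hV.inter hV.inv).isClosed_compl
    (Set.disjoint_compl_right_iff_subset.2 (by simpa using h1V))
  let g : G → ℝ := fun x => f x + f x⁻¹
  have hg : Continuous g := f.continuous.add (f.continuous.comp continuous_inv)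
  have hgc : HasCompactSupport g := hfc.add (hfc.comp_homeomorph (Homeomorph.inv G))
  have hg0 : ∀ x, 0 ≤ g x := fun x => add_nonneg (hf x).1 (hf x⁻¹).1
  have hc : 0 < ∫ x, g x ∂μ := by
    refine hg.integral_pos_of_hasCompactSupport_nonneg_nonzero (x := 1) hgc hg0 ?_
    have : f 1 = 1 := hf1 rfl
    simp [g, this]
  refine ⟨fun x => g x / ∫ x, g x ∂μ, hg.div_const _, ?_, fun x => div_nonneg (hg0 x) hc.le,
    fun x => ?_, fun x hx => ?_, ?_⟩
  · have h2 : (fun x => g x / ∫ x, g x ∂μ) = g * fun _ => (∫ x, g x ∂μ)⁻¹ :=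
      funext fun x => div_eq_mul_inv _ _
    rw [h2]
    exact hgc.mul_right
  · simp [g, add_comm]
  · have h2 : f x = 0 := hf0 fun h => hx h.1
    have h3 : f x⁻¹ = 0 := hf0 fun h => hx (by simpa using h.2)
    simp [g, h2, h3]
  · rw [integral_div, div_self hc.ne']

/-- Averages of values close to `c` are close to `c`. -/
theorem norm_integral_smul_sub_le {X E : Type*} [MeasurableSpace X] {μ : Measure X}
    [NormedAddCommGroup E] [NormedSpace ℝ E] [CompleteSpace E] {w : X → ℝ} {k : X → E} {c : E}
    {ε : ℝ} (hw : Integrable w μ) (hw0 : ∀ x, 0 ≤ w x) (hw1 : ∫ x, w x ∂μ = 1)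
    (hk : Integrable (fun x => w x • k x) μ) (h : ∀ x, w x ≠ 0 → ‖k x - c‖ ≤ ε) :
    ‖∫ x, w x • k x ∂μ - c‖ ≤ ε := by
  have h1 : ∫ x, w x • k x ∂μ - c = ∫ x, (w x • k x - w x • c) ∂μ := by
    rw [integral_sub hk (hw.smul_const c), integral_smul_const, hw1, one_smul]
  have h2 : ∫ x, w x * ε ∂μ = ε := by rw [integral_mul_const, hw1, one_mul]
  rw [h1, ← h2]
  refine norm_integral_le_of_norm_le (hw.mul_const ε) (Eventually.of_forall fun x => ?_)
  rw [← smul_sub, norm_smul, Real.norm_of_nonneg (hw0 x)]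
  by_cases hx : w x = 0
  · simp [hx]
  · exact mul_le_mul_of_nonneg_left (h x hx) (hw0 x)

variable {A : Type*} [NonUnitalCStarAlgebra A] (T : TwistedAction G A) (μ : Measure G)
  [μ.IsHaarMeasure]

/-- The function `y ↦ φ(y) b`. -/
def CcOn.tensor {H : Subgroup G} (φ : G → ℝ) (hφ : Continuous φ) (hφc : HasCompactSupport φ)
    (hφH : ∀ x ∉ H, φ x = 0) (b : A) : CcOn H A :=
  ⟨fun y => φ y • b, hφ.smul continuous_const, hφc.smul_right, fun x hx => by
    simp [hφH x hx]⟩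

/-- The convolution is the φ-average of b S_y Ψ(x). One ε pays for replacing S_y Ψ by Ψ, the other
for removing b. -/
theorem TwistedAction.norm_conv_tensor_sub_le {H : Subgroup G} (Ψ : CcOn H A) {φ : G → ℝ}
    (hφ : Continuous φ) (hφc : HasCompactSupport φ) (hφ0 : ∀ x, 0 ≤ φ x) (hφ1 : ∫ x, φ x ∂μ = 1)
    {b : A} (hb1 : ‖b‖ ≤ 1) {ε : ℝ} (hb : ∀ x, ‖b * (Ψ : G → A) x - (Ψ : G → A) x‖ ≤ ε)
    (hV : ∀ v, φ v ≠ 0 → ∀ x, ‖T.shift v Ψ x - (Ψ : G → A) x‖ ≤ ε) (x : G) :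
    ‖T.conv μ (fun y => φ y • b) Ψ x - (Ψ : G → A) x‖ ≤ ε + ε := by
  have hi := T.integrable_conv_integrand μ (Φ := fun y => φ y • b) (hφ.smul continuous_const)
    hφc.smul_right Ψ.2.1 x
  simp only [smul_mul_assoc] at hi
  have h1 : T.conv μ (fun y => φ y • b) Ψ x = ∫ y, φ y • (b * T.shift y Ψ x) ∂μ :=
    integral_congr_ae (Eventually.of_forall fun y => smul_mul_assoc _ _ _)
  rw [h1]
  refine norm_integral_smul_sub_le (hφ.integrable_of_hasCompactSupport hφc) hφ0 hφ1 hi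
    fun y hy => ?_
  have h2 : b * T.shift y Ψ x - (Ψ : G → A) x =
      b * (T.shift y Ψ x - (Ψ : G → A) x) + (b * (Ψ : G → A) x - (Ψ : G → A) x) := by
    rw [mul_sub]; abel
  rw [h2]
  refine (norm_add_le _ _).trans (add_le_add ?_ (hb x))
  exact (norm_mul_le _ _).trans
    ((mul_le_of_le_one_left (norm_nonneg _) hb1).trans (hV y hy x))

/-- With y = x v⁻¹ the averaged term is Ψ(x v⁻¹) α_{x v⁻¹}(b) ω(x v⁻¹, v). One ε moves v to the
identity, where the twist is 1, and the other removes α_x(b). -/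
theorem TwistedAction.norm_conv_tensor_sub_le' {H : Subgroup G} (Ψ : CcOn H A) {φ : G → ℝ}
    (hφ : Continuous φ) (hφc : HasCompactSupport φ) (hφ0 : ∀ x, 0 ≤ φ x) (hφ1 : ∫ x, φ x ∂μ = 1)
    (hφi : ∀ x, φ x⁻¹ = φ x)
    {b : A} {ε : ℝ} (hb : ∀ x, ‖(Ψ : G → A) x * T.α x b - (Ψ : G → A) x‖ ≤ ε)
    (hV : ∀ v, φ v ≠ 0 → ∀ x, ‖(Ψ : G → A) (x * v⁻¹) *
      mulMultiplier (T.α (x * v⁻¹) b) (T.ω (x * v⁻¹) v : 𝓜(ℂ, A)) -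
        (Ψ : G → A) x * T.α x b‖ ≤ ε) (x : G) :
    ‖T.conv μ Ψ (fun y => φ y • b) x - (Ψ : G → A) x‖ ≤ ε + ε := by
  have hi := T.integrable_conv_integrand μ (Φ := Ψ) (Ψ := fun y => φ y • b) Ψ.2.1 Ψ.2.2.1
    (hφ.smul continuous_const) x
  have h0 : ∀ y, (Ψ : G → A) y * T.shift y (fun y => φ y • b) x = φ (y⁻¹ * x) •
      ((Ψ : G → A) y * mulMultiplier (T.α y b) (T.ω y (y⁻¹ * x) : 𝓜(ℂ, A))) := fun y => by
    rw [TwistedAction.shift, ← Complex.coe_smul, map_smul, mulMultiplier_smul, mul_smul_comm,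
      Complex.coe_smul]
  simp only [h0] at hi
  have h1 : T.conv μ Ψ (fun y => φ y • b) x = ∫ y, φ (y⁻¹ * x) •
      ((Ψ : G → A) y * mulMultiplier (T.α y b) (T.ω y (y⁻¹ * x) : 𝓜(ℂ, A))) ∂μ :=
    integral_congr_ae (Eventually.of_forall h0)
  have h2 : ∀ y, φ (y⁻¹ * x) = φ (x⁻¹ * y) := fun y => by rw [← hφi]; simp
  rw [h1]
  refine norm_integral_smul_sub_le (w := fun y => φ (y⁻¹ * x)) ?_ (fun y => hφ0 _) ?_ hi
    fun y hy => ?_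
  · simp only [h2]
    exact (hφ.comp (continuous_const_mul x⁻¹)).integrable_of_hasCompactSupport
      (hφc.comp_homeomorph (Homeomorph.mulLeft x⁻¹))
  · simp only [h2]
    rw [integral_mul_left_eq_self (μ := μ) φ x⁻¹, hφ1]
  · have h3 := hV _ hy x
    have h4 : x * (y⁻¹ * x)⁻¹ = y := by group
    rw [h4] at h3
    have h5 := hb x
    refine le_trans ?_ (add_le_add h3 h5)
    refine le_trans (le_of_eq ?_) (norm_add_le _ _)
    congr 1
    abel

/-- Two-sided approximate identities of norm at most one, supported in a given open subgroup. -/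
theorem TwistedAction.exists_approx_identity {H H' : Subgroup G} (hH : IsOpen (H : Set G))
    (hHH' : H ≤ H') {κ : Type*} [Finite κ] (Ψ : κ → CcOn H' A) {ε : ℝ} (hε : 0 < ε) :
    ∃ e : CcOn H A, ‖TwistedL1.ofCc T μ H e‖ ≤ 1 ∧ ∀ i,
      ‖TwistedL1.ofCc T μ H' (T.convCc μ ⟨e, CcOn.mono hHH' e.2⟩ (Ψ i) - Ψ i)‖ ≤ ε ∧
      ‖TwistedL1.ofCc T μ H' (T.convCc μ (Ψ i) ⟨e, CcOn.mono hHH' e.2⟩ - Ψ i)‖ ≤ ε := by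
  obtain ⟨C, hC, hC1⟩ := exists_compact_mem_nhds (1 : G)
  let S : κ → Set G := fun i => tsupport (Ψ i : G → A)
  have hS : ∀ i, IsCompact (S i) := fun i => (Ψ i).2.2.1
  have hS0 : ∀ i, ∀ x ∉ S i, (Ψ i : G → A) x = 0 := fun i x => image_eq_zero_of_notMem_tsupport
  let K : Set G := ⋃ i, ((fun p : G × G => p.1 * p.2) '' (C ×ˢ S i) ∪
    (fun p : G × G => p.1 * p.2) '' (S i ×ˢ C))
  have hK : IsCompact K := isCompact_iUnion fun i =>
    ((hC.prod (hS i)).image continuous_mul).union (((hS i).prod hC).image continuous_mul)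
  have hK1 : ∀ i, ∀ v ∈ C, ∀ x ∉ K, (Ψ i : G → A) (v⁻¹ * x) = 0 := fun i v hv x hx =>
    hS0 i _ fun h => hx (Set.mem_iUnion.2 ⟨i, Or.inl ⟨(v, v⁻¹ * x), ⟨hv, h⟩, by simp⟩⟩)
  have hK2 : ∀ i, ∀ v ∈ C, ∀ x ∉ K, (Ψ i : G → A) (x * v⁻¹) = 0 := fun i v hv x hx =>
    hS0 i _ fun h => hx (Set.mem_iUnion.2 ⟨i, Or.inr ⟨(x * v⁻¹, v), ⟨h, hv⟩, by simp⟩⟩)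
  have hK3 : ∀ i, ∀ x ∉ K, (Ψ i : G → A) x = 0 := fun i x hx => by
    simpa using hK2 i 1 (mem_of_mem_nhds hC1) x hx
  -- All errors are supported in K and bounded there by 2δ, so their L¹-norm is at most 2δ μ(K).
  obtain ⟨δ, hδ, hδε⟩ : ∃ δ : ℝ, 0 < δ ∧ (δ + δ) * μ.real K ≤ ε := by
    refine ⟨ε / (2 * (μ.real K + 1)), by positivity, ?_⟩
    have h0 : 0 ≤ μ.real K := measureReal_nonneg
    have : (ε / (2 * (μ.real K + 1)) + ε / (2 * (μ.real K + 1))) * μ.real K =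
        ε * (μ.real K / (μ.real K + 1)) := by field_simp; ring
    rw [this]
    exact mul_le_of_le_one_right hε.le ((div_le_one (by positivity)).2 (by linarith))
  -- The values (α x)⁻¹ (Ψ i x) are included because applying the isometry α x turns the estimate
  -- for them into Ψ i x · α x b ≈ Ψ i x.
  obtain ⟨b, hb1, hb⟩ := exists_approx_unit_of_isCompact (Z := ⋃ i, ((Ψ i : G → A) '' S i ∪
    (fun x => (T.α x).symm ((Ψ i : G → A) x)) '' S i)) (isCompact_iUnion fun i =>
      ((hS i).image (Ψ i).2.1).union ((hS i).image (T.continuous_α_symm (Ψ i).2.1))) hδ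
  have hbl : ∀ i x, ‖b * (Ψ i : G → A) x - (Ψ i : G → A) x‖ ≤ δ := fun i x => by
    by_cases hx : x ∈ S i
    · exact (hb _ (Set.mem_iUnion.2 ⟨i, Or.inl ⟨x, hx, rfl⟩⟩)).1
    · simpa [hS0 i x hx] using hδ.le
  have hbr : ∀ i x, ‖(Ψ i : G → A) x * T.α x b - (Ψ i : G → A) x‖ ≤ δ := fun i x => by
    by_cases hx : x ∈ S i
    · have h1 := (hb _ (Set.mem_iUnion.2 ⟨i, Or.inr ⟨x, hx, rfl⟩⟩)).2
      rw [← StarAlgEquiv.norm_apply (T.α x), map_sub, map_mul] at h1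
      simpa using h1
    · simpa [hS0 i x hx] using hδ.le
  have hl : ∀ᶠ v in 𝓝 (1 : G), ∀ i, ∀ x, ‖T.shift v (Ψ i) x - (Ψ i : G → A) x‖ ≤ δ := by
    refine eventually_all.2 fun i => eventually_forall_norm_le
      ((T.continuous_shift (Ψ i).2.1).sub ((Ψ i).2.1.comp continuous_snd))
      (fun x => by rw [T.shift_one, sub_self]) hC1 hK (fun v hv x hx => ?_) hδ
    rw [T.shift_eq_zero (hK1 i v hv x hx), hK3 i x hx, sub_self]
  have hr : ∀ᶠ v in 𝓝 (1 : G), ∀ i, ∀ x, ‖(Ψ i : G → A) (x * v⁻¹) *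
      mulMultiplier (T.α (x * v⁻¹) b) (T.ω (x * v⁻¹) v : 𝓜(ℂ, A)) -
        (Ψ i : G → A) x * T.α x b‖ ≤ δ := by
    refine eventually_all.2 fun i => eventually_forall_norm_le (F := fun v x =>
      (Ψ i : G → A) (x * v⁻¹) * mulMultiplier (T.α (x * v⁻¹) b) (T.ω (x * v⁻¹) v : 𝓜(ℂ, A)) -
        (Ψ i : G → A) x * T.α x b) ?_
      (fun x => by simp [T.ω_one_right, mulMultiplier_one]) hC1 hK (fun v hv x hx => ?_) hδ
    · have h1 : Continuous fun p : G × G => p.2 * p.1⁻¹ := by fun_prop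
      have h2 : Continuous fun p : G × G =>
          mulMultiplier (T.α (p.2 * p.1⁻¹) b) (T.ω (p.2 * p.1⁻¹) p.1 : 𝓜(ℂ, A)) :=
        T.continuous_act.comp (continuous_const.prodMk (h1.prodMk continuous_fst))
      exact (((Ψ i).2.1.comp h1).mul h2).sub (((Ψ i).2.1.comp continuous_snd).mul
        ((T.continuous_α b).comp continuous_snd))
    · rw [hK2 i v hv x hx, hK3 i x hx, zero_mul, zero_mul, sub_self]
  obtain ⟨V, hV, hVo, h1V⟩ := eventually_nhds_iff.1
    ((hl.and hr).and ((eventually_mem_set.2 hC1).and (hH.mem_nhds H.one_mem)))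
  obtain ⟨φ, hφ, hφc, hφ0, hφi, hφV, hφ1⟩ := exists_symmetric_bump μ hVo h1V
  have hφV' : ∀ v, φ v ≠ 0 → v ∈ V := fun v hv => by
    by_contra h
    exact hv (hφV v h)
  have hφC : ∀ x ∉ C, φ x = 0 := fun x hx => hφV x fun h => hx (hV x h).2.1
  let e : CcOn H A := CcOn.tensor φ hφ hφc (fun x hx => hφV x fun h => hx (hV x h).2.2) b
  refine ⟨e, ?_, fun i => ⟨?_, ?_⟩⟩
  · rw [TwistedL1.norm_ofCc]
    have h1 : ∀ x, ‖(e : G → A) x‖ = φ x * ‖b‖ := fun x => by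
      change ‖φ x • b‖ = _
      rw [norm_smul, Real.norm_of_nonneg (hφ0 x)]
    simp only [h1]
    rw [integral_mul_const, hφ1, one_mul]
    exact hb1
  · refine (TwistedL1.norm_ofCc_le T μ _ hK (fun x _ => T.norm_conv_tensor_sub_le μ (Ψ i) hφ hφc
      hφ0 hφ1 hb1 (hbl i) (fun v hv => (hV v (hφV' v hv)).1.1 i) x) fun x hx => ?_).trans hδε
    change T.conv μ e (Ψ i) x - (Ψ i : G → A) x = 0
    rw [hK3 i x hx, sub_zero]
    refine integral_eq_zero_of_ae (Eventually.of_forall fun y => ?_)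
    change φ y • b * T.shift y (Ψ i) x = 0
    by_cases hy : y ∈ C
    · rw [T.shift_eq_zero (hK1 i y hy x hx), mul_zero]
    · rw [hφC y hy, zero_smul, zero_mul]
  · refine (TwistedL1.norm_ofCc_le T μ _ hK (fun x _ => T.norm_conv_tensor_sub_le' μ (Ψ i) hφ hφc
      hφ0 hφ1 hφi (hbr i) (fun v hv => (hV v (hφV' v hv)).1.2 i) x) fun x hx => ?_).trans hδε
    change T.conv μ (Ψ i) e x - (Ψ i : G → A) x = 0
    rw [hK3 i x hx, sub_zero]
    refine integral_eq_zero_of_ae (Eventually.of_forall fun y => ?_)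
    change (Ψ i : G → A) y * T.shift y e x = 0
    by_cases hy : y⁻¹ * x ∈ C
    · have := hK2 i _ hy x hx
      rw [show x * (y⁻¹ * x)⁻¹ = y by group] at this
      rw [this, zero_mul]
    · rw [T.shift_eq_zero, mul_zero]
      change φ (y⁻¹ * x) • b = 0
      rw [hφC _ hy, zero_smul]

end ApproximateIdentity

/-! ### Representations of the twisted convolution algebra -/

section Representations

/-- A compact neighbourhood of 1 among the generators makes the subgroup open. Hence every compactly
supported function lives on an open compactly generated subgroup. -/
theorem exists_isOpen_isCompactlyGenerated {G : Type*} [Group G] [TopologicalSpace G]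
    [IsTopologicalGroup G] [LocallyCompactSpace G] {C : Set G} (hC : IsCompact C) :
    ∃ H : Subgroup G, IsOpen (H : Set G) ∧ H.IsCompactlyGenerated ∧ C ⊆ H := by
  obtain ⟨K, hK, hK1⟩ := exists_compact_mem_nhds (1 : G)
  have hsub : C ∪ K ⊆ (Subgroup.closure (C ∪ K) : Set G) := Subgroup.subset_closure
  refine ⟨Subgroup.closure (C ∪ K), ?_, ⟨C ∪ K, hC.union hK, rfl⟩,
    Set.subset_union_left.trans hsub⟩
  exact Subgroup.isOpen_of_mem_nhds _
    (Filter.mem_of_superset hK1 (Set.subset_union_right.trans hsub))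

variable {G : Type*} [Group G] [TopologicalSpace G] [IsTopologicalGroup G] [LocallyCompactSpace G]
  [T2Space G] [MeasurableSpace G] [BorelSpace G] {A : Type*} [NonUnitalCStarAlgebra A]
  {T : TwistedAction G A} {μ : Measure G} [μ.IsHaarMeasure]
  {R : Type*} [NormedRing R] [NormedAlgebra ℂ R]

/-- The restriction of an operator on `L¹` to the compactly supported functions on `H`. -/
def TwistedL1.compCc (φ : TwistedL1 T μ →L[ℂ] R) (H : Subgroup G) : CcOn H A →ₗ[ℂ] R :=
  (φ : TwistedL1 T μ →ₗ[ℂ] R) ∘ₗ TwistedL1.ofCc T μ H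

theorem TwistedL1.compCc_apply (φ : TwistedL1 T μ →L[ℂ] R) (H : Subgroup G) (f : CcOn H A) :
    TwistedL1.compCc φ H f = φ (TwistedL1.ofCc T μ H f) := rfl

theorem TwistedL1.range_compCc_mono (φ : TwistedL1 T μ →L[ℂ] R) {H H' : Subgroup G} (h : H ≤ H') :
    LinearMap.range (TwistedL1.compCc φ H) ≤ LinearMap.range (TwistedL1.compCc φ H') := by
  rintro _ ⟨f, rfl⟩
  exact ⟨⟨f, CcOn.mono h f.2⟩, rfl⟩

theorem TwistedL1.finiteDimensional_range_compCc (φ : TwistedL1 T μ →L[ℂ] R) (H : Subgroup G)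
    [FiniteDimensional ℂ ((TwistedL1.ofSubgroup T μ H).map (φ : TwistedL1 T μ →ₗ[ℂ] R))] :
    FiniteDimensional ℂ (LinearMap.range (TwistedL1.compCc φ H)) := by
  refine Submodule.finiteDimensional_of_le
    (S₂ := (TwistedL1.ofSubgroup T μ H).map (φ : TwistedL1 T μ →ₗ[ℂ] R)) ?_
  rintro _ ⟨f, rfl⟩
  exact ⟨_, TwistedL1.ofCc_mem_ofSubgroup T μ f, rfl⟩

variable [μ.Regular] {φ : TwistedL1 T μ →L[ℂ] R}

theorem TwistedL1.compCc_convCc (hφ : ∀ a b, φ (a * b) = φ a * φ b) {H : Subgroup G}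
    (Φ Ψ : CcOn H A) : TwistedL1.compCc φ H (T.convCc μ Φ Ψ) =
      TwistedL1.compCc φ H Φ * TwistedL1.compCc φ H Ψ := by
  rw [TwistedL1.compCc_apply, ← TwistedL1.ofCc_mul_ofCc, hφ]
  rfl

theorem TwistedL1.mul_mem_range_compCc (hφ : ∀ a b, φ (a * b) = φ a * φ b) {H : Subgroup G} :
    ∀ a ∈ LinearMap.range (TwistedL1.compCc φ H), ∀ b ∈ LinearMap.range (TwistedL1.compCc φ H),
      a * b ∈ LinearMap.range (TwistedL1.compCc φ H) := by
  rintro _ ⟨f, rfl⟩ _ ⟨g, rfl⟩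
  exact ⟨T.convCc μ f g, TwistedL1.compCc_convCc hφ f g⟩

/-- Finite-dimensional images of the twisted convolution algebra of an open subgroup are unital. -/
theorem TwistedL1.exists_unit (hφ : ∀ a b, φ (a * b) = φ a * φ b) {H H' : Subgroup G}
    (hH : IsOpen (H : Set G)) (hHH' : H ≤ H')
    [FiniteDimensional ℂ (LinearMap.range (TwistedL1.compCc φ H'))] :
    ∃ e ∈ LinearMap.range (TwistedL1.compCc φ H),
      ∀ a ∈ LinearMap.range (TwistedL1.compCc φ H'), e * a = a ∧ a * e = a := by
  have : FiniteDimensional ℂ (LinearMap.range (TwistedL1.compCc φ H)) :=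
    Submodule.finiteDimensional_of_le (TwistedL1.range_compCc_mono φ hHH')
  let B := Module.finBasis ℂ (LinearMap.range (TwistedL1.compCc φ H'))
  choose Ψ hΨ using fun i => (B i).2
  -- The approximate units are supported in the smaller group H but tested on lifts of a basis of
  -- the image for H'. Their images are bounded, so a subsequence converges in the
  -- finite-dimensional image for H, and the limit is a unit for the larger image.
  choose e he1 he2 using fun n : ℕ => T.exists_approx_identity μ hH hHH' Ψ
    (ε := 1 / (n + 1)) (by positivity)
  let q : ℕ → LinearMap.range (TwistedL1.compCc φ H) := fun n => ⟨_, ⟨e n, rfl⟩⟩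
  have hq : ∀ n, q n ∈ Metric.closedBall (0 : LinearMap.range (TwistedL1.compCc φ H)) ‖φ‖ := by
    intro n
    rw [mem_closedBall_zero_iff]
    exact (φ.le_opNorm _).trans (mul_le_of_le_one_right (norm_nonneg _) (he1 n))
  have : ProperSpace (LinearMap.range (TwistedL1.compCc φ H)) := FiniteDimensional.proper ℂ _
  obtain ⟨e₀, -, σ, hσ, hlim⟩ := (isCompact_closedBall _ _).tendsto_subseq hq
  have hlim' : Tendsto (fun n => TwistedL1.compCc φ H (e (σ n))) atTop (𝓝 (e₀ : R)) :=
    (continuous_subtype_val.tendsto e₀).comp hlim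
  have h0 : Tendsto (fun n => ‖φ‖ * (1 / ((σ n : ℝ) + 1))) atTop (𝓝 0) := by
    simpa using (tendsto_one_div_add_atTop_nhds_zero_nat.comp hσ.tendsto_atTop).const_mul ‖φ‖
  refine ⟨e₀, e₀.2, ?_⟩
  have hB : ∀ i, e₀ * (B i : R) = B i ∧ (B i : R) * e₀ = B i := by
    intro i
    have key : ∀ {u : ℕ → R} {w : R}, Tendsto u atTop (𝓝 w) →
        (∀ n, ‖u n - B i‖ ≤ ‖φ‖ * (1 / ((σ n : ℝ) + 1))) → w = B i := fun hu hle =>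
      tendsto_nhds_unique hu (tendsto_iff_norm_sub_tendsto_zero.2
        (squeeze_zero (fun _ => norm_nonneg _) hle h0))
    constructor
    · refine key (hlim'.mul_const (B i : R)) fun n => ?_
      have h1 : TwistedL1.compCc φ H (e (σ n)) * (B i : R) - B i = TwistedL1.compCc φ H'
          (T.convCc μ ⟨e (σ n), CcOn.mono hHH' (e (σ n)).2⟩ (Ψ i) - Ψ i) := by
        rw [map_sub, TwistedL1.compCc_convCc hφ, hΨ]
        rfl
      rw [h1]
      exact (φ.le_opNorm _).trans (mul_le_mul_of_nonneg_left (he2 (σ n) i).1 (norm_nonneg _))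
    · refine key (hlim'.const_mul (B i : R)) fun n => ?_
      have h1 : (B i : R) * TwistedL1.compCc φ H (e (σ n)) - B i = TwistedL1.compCc φ H'
          (T.convCc μ (Ψ i) ⟨e (σ n), CcOn.mono hHH' (e (σ n)).2⟩ - Ψ i) := by
        rw [map_sub, TwistedL1.compCc_convCc hφ, hΨ]
        rfl
      rw [h1]
      exact (φ.le_opNorm _).trans (mul_le_mul_of_nonneg_left (he2 (σ n) i).2 (norm_nonneg _))
  intro a ha
  have hsum : a = ∑ i, B.repr ⟨a, ha⟩ i • (B i : R) := by
    have h := congrArg Subtype.val (B.sum_repr ⟨a, ha⟩)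
    rw [AddSubmonoidClass.coe_finsetSum] at h
    exact h.symm
  constructor
  · rw [hsum, Finset.mul_sum]
    exact Finset.sum_congr rfl fun i _ => by rw [mul_smul_comm, (hB i).1]
  · rw [hsum, Finset.sum_mul]
    exact Finset.sum_congr rfl fun i _ => by rw [smul_mul_assoc, (hB i).2]

/-- The kernel of a representation is invariant under twisted translations. -/
theorem TwistedL1.compCc_translateEquiv_eq_zero (hφ : ∀ a b, φ (a * b) = φ a * φ b)
    {H : Subgroup G} (hH : IsOpen (H : Set G)) (u : unitary 𝓜(ℂ, A)) {y : G} (hy : y ∈ H)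
    {Φ : CcOn H A} (hΦ : TwistedL1.compCc φ H Φ = 0) :
    TwistedL1.compCc φ H (T.translateEquiv u hy Φ) = 0 := by
  have h : ∀ ε > 0, ‖TwistedL1.compCc φ H (T.translateEquiv u hy Φ)‖ ≤ ‖φ‖ * ε := by
    intro ε hε
    obtain ⟨e, -, he⟩ := T.exists_approx_identity μ hH le_rfl (fun _ : Unit => Φ) hε
    -- Translation moves onto the left factor of e * Φ, and φ kills that product because φ(Φ) = 0.
    -- What remains is the isometric translate of the small error e * Φ - Φ.
    have h1 : TwistedL1.compCc φ H (T.translateEquiv u hy Φ) =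
        -TwistedL1.compCc φ H (T.translateEquiv u hy (T.convCc μ e Φ - Φ)) := by
      rw [map_sub, map_sub, T.translateEquiv_convCc, TwistedL1.compCc_convCc hφ, hΦ, mul_zero,
        zero_sub, neg_neg]
    rw [h1, norm_neg]
    refine (φ.le_opNorm _).trans (mul_le_mul_of_nonneg_left ?_ (norm_nonneg _))
    rw [T.norm_ofCc_translateEquiv]
    exact (he ()).1
  rw [← norm_le_zero_iff]
  refine le_of_forall_pos_le_add fun δ hδ => ?_
  refine (h (δ / (‖φ‖ + 1)) (by positivity)).trans ?_
  rw [zero_add, mul_div_assoc', div_le_iff₀ (by positivity)]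
  nlinarith [norm_nonneg φ]

/-- Finite-dimensional images of the twisted convolution algebra of an open subgroup are von Neumann
regular. -/
theorem TwistedL1.regular_range_compCc (hφ : ∀ a b, φ (a * b) = φ a * φ b) {H : Subgroup G}
    (hH : IsOpen (H : Set G)) [FiniteDimensional ℂ (LinearMap.range (TwistedL1.compCc φ H))]
    {a : R} (ha : a ∈ LinearMap.range (TwistedL1.compCc φ H)) :
    ∃ x ∈ LinearMap.range (TwistedL1.compCc φ H), a * x * a = a := by
  obtain ⟨_, ⟨E, rfl⟩, hE⟩ := TwistedL1.exists_unit hφ hH (le_refl H)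
  refine regular_of_isometries (TwistedL1.ofCc T μ H) φ (TwistedL1.compCc φ H) (fun _ => rfl)
    (TwistedL1.mul_mem_range_compCc hφ) ⟨E, rfl⟩ hE ?_ ha
  set Q := Submodule.span ℂ {k | k ∈ LinearMap.range (TwistedL1.compCc φ H) ∧
    ∃ L : CcOn H A ≃ₗ[ℂ] CcOn H A, (∀ x, ‖TwistedL1.ofCc T μ H (L x)‖ = ‖TwistedL1.ofCc T μ H x‖) ∧
      ∀ x, TwistedL1.compCc φ H (L x) = k * TwistedL1.compCc φ H x} with hQ
  have hQle : Q ≤ LinearMap.range (TwistedL1.compCc φ H) := Submodule.span_le.2 fun k hk => hk.1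
  have : FiniteDimensional ℂ Q := Submodule.finiteDimensional_of_le hQle
  -- The image of u S_y E implements u S_y by left multiplication: Ψ - E * Ψ lies in the kernel,
  -- which translations preserve.
  have htr : ∀ (u : unitary 𝓜(ℂ, A)) (y : G) (hy : y ∈ H),
      TwistedL1.compCc φ H (T.translateEquiv u hy E) ∈ Q := by
    intro u y hy
    refine Submodule.subset_span ⟨⟨_, rfl⟩, T.translateEquiv u hy,
      T.norm_ofCc_translateEquiv μ u hy, fun Ψ => ?_⟩
    rw [← TwistedL1.compCc_convCc hφ, ← T.translateEquiv_convCc, eq_comm, ← sub_eq_zero, ← map_sub,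
      ← map_sub]
    refine TwistedL1.compCc_translateEquiv_eq_zero hφ hH u hy ?_
    rw [map_sub, TwistedL1.compCc_convCc hφ, (hE _ ⟨Ψ, rfl⟩).1, sub_self]
  have hm : ∀ (m : 𝓜(ℂ, A)) (y : G) (hy : y ∈ H),
      TwistedL1.compCc φ H ⟨T.translate m y E, T.translate_mem_ccOn m hy E⟩ ∈ Q := by
    intro m y hy
    let ψ : 𝓜(ℂ, A) →ₗ[ℂ] CcOn H A :=
      { toFun := fun m => ⟨T.translate m y E, T.translate_mem_ccOn m hy E⟩
        map_add' := fun m n => Subtype.ext (by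
          funext z
          simp [TwistedAction.translate])
        map_smul' := fun c m => Subtype.ext (by
          funext z
          simp [TwistedAction.translate]) }
    -- Unitaries span the multiplier algebra, so arbitrary multipliers, in particular elements of A,
    -- may replace u.
    have h1 : Submodule.span ℂ (unitary 𝓜(ℂ, A) : Set 𝓜(ℂ, A)) ≤
        Q.comap (TwistedL1.compCc φ H ∘ₗ ψ) :=
      Submodule.span_le.2 fun u hu => htr ⟨u, hu⟩ y hy
    rw [CStarAlgebra.span_unitary] at h1
    exact h1 (Submodule.mem_top (x := m))
  rintro _ ⟨Φ, rfl⟩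
  -- Φ * E is an integral of translates Φ(y) S_y E, and it has the same image as Φ because E maps to
  -- the unit.
  have hcl : IsClosed (Q.comap (φ : TwistedL1 T μ →ₗ[ℂ] R) : Set (TwistedL1 T μ)) :=
    Q.closed_of_finiteDimensional.preimage φ.continuous
  have h2 := T.mem_of_translate_mem μ Φ E (Q.comap (φ : TwistedL1 T μ →ₗ[ℂ] R)) hcl
    fun a y hy => hm _ y hy
  have h3 : TwistedL1.compCc φ H (T.convCc μ Φ E) ∈ Q := h2
  rwa [TwistedL1.compCc_convCc hφ, (hE _ ⟨Φ, rfl⟩).2] at h3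

/-- The unital algebra generated by the image of the compactly supported functions on `H`. -/
def TwistedL1.unitalRange (hφ : ∀ a b, φ (a * b) = φ a * φ b) (H : Subgroup G) :
    Subalgebra ℂ R where
  carrier := {r | ∃ (f : CcOn H A) (c : ℂ), r = TwistedL1.compCc φ H f + algebraMap ℂ R c}
  mul_mem' := by
    rintro _ _ ⟨f, c, rfl⟩ ⟨g, d, rfl⟩
    refine ⟨T.convCc μ f g + c • g + d • f, c * d, ?_⟩
    simp only [map_add, map_smul, TwistedL1.compCc_convCc hφ, map_mul, Algebra.algebraMap_eq_smul_one,
      add_mul, mul_add, smul_mul_assoc, mul_smul_comm, one_mul, mul_one, smul_smul,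
      smul_add]
    abel
  add_mem' := by
    rintro _ _ ⟨f, c, rfl⟩ ⟨g, d, rfl⟩
    refine ⟨f + g, c + d, ?_⟩
    simp only [map_add]
    abel
  algebraMap_mem' c := ⟨0, c, by simp⟩

theorem TwistedL1.isIntegral_of_mem_unitalRange (hφ : ∀ a b, φ (a * b) = φ a * φ b)
    {H : Subgroup G} [FiniteDimensional ℂ (LinearMap.range (TwistedL1.compCc φ H))] {r : R}
    (hr : r ∈ TwistedL1.unitalRange hφ H) : IsIntegral ℂ r := by
  refine IsIntegral.of_mem_of_fg (TwistedL1.unitalRange hφ H) ?_ r hr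
  have hle : Subalgebra.toSubmodule (TwistedL1.unitalRange hφ H) ≤
      LinearMap.range (TwistedL1.compCc φ H) ⊔ Submodule.span ℂ {1} := by
    rintro _ ⟨f, c, rfl⟩
    refine Submodule.add_mem_sup ⟨f, rfl⟩ ?_
    rw [Algebra.algebraMap_eq_smul_one]
    exact Submodule.smul_mem _ c (Submodule.mem_span_singleton_self _)
  have := Submodule.finiteDimensional_of_le hle
  exact (Submodule.fg_iff_finiteDimensional _).2 this

/-- If the images of the convolution algebras of the open compactly generated subgroups are
finite-dimensional, then the image of the compactly supported functions generates an algebraic von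
Neumann regular algebra. -/
theorem TwistedL1.regular_unitalRange (hφ : ∀ a b, φ (a * b) = φ a * φ b)
    (hfin : ∀ H : Subgroup G, IsOpen (H : Set G) → H.IsCompactlyGenerated →
      FiniteDimensional ℂ ((TwistedL1.ofSubgroup T μ H).map (φ : TwistedL1 T μ →ₗ[ℂ] R))) :
    ∀ r ∈ TwistedL1.unitalRange hφ ⊤, IsIntegral ℂ r ∧
      ∃ x ∈ TwistedL1.unitalRange hφ ⊤, r * x * r = r := by
  have hfin' : ∀ H : Subgroup G, IsOpen (H : Set G) → H.IsCompactlyGenerated →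
      FiniteDimensional ℂ (LinearMap.range (TwistedL1.compCc φ H)) := fun H h1 h2 =>
    have := hfin H h1 h2
    TwistedL1.finiteDimensional_range_compCc φ H
  obtain ⟨H₀, hH₀, ⟨K₀, hK₀, hKH₀⟩, -⟩ :=
    exists_isOpen_isCompactlyGenerated (isCompact_empty (X := G))
  have := hfin' H₀ hH₀ ⟨K₀, hK₀, hKH₀⟩
  obtain ⟨e, he, hunit⟩ := TwistedL1.exists_unit hφ hH₀ (le_refl H₀)
  rintro _ ⟨f, c, rfl⟩
  obtain ⟨H, hH, hHc, hsub⟩ := exists_isOpen_isCompactlyGenerated (hK₀.union f.2.2.1)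
  have hHH₀ : H₀ ≤ H := by
    rw [← hKH₀, Subgroup.closure_le]
    exact Set.subset_union_left.trans hsub
  have hfH : (f : G → A) ∈ CcOn H A := ⟨f.2.1, f.2.2.1, fun x hx =>
    image_eq_zero_of_notMem_tsupport fun h => hx (hsub (Or.inr h))⟩
  have := hfin' H hH hHc
  obtain ⟨e', he', hunit'⟩ := TwistedL1.exists_unit hφ hH₀ hHH₀
  -- The unit for H found inside the image for H₀ must be the unit for H₀, so one idempotent works
  -- for every H containing H₀.
  have hee : e' = e := by
    rw [← (hunit e' he').2, (hunit' e (TwistedL1.range_compCc_mono φ hHH₀ he)).1]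
  subst hee
  have heH := TwistedL1.range_compCc_mono φ hHH₀ he
  refine ⟨TwistedL1.isIntegral_of_mem_unitalRange hφ (H := H) ⟨⟨f, hfH⟩, c, rfl⟩, ?_⟩
  -- With d = 1 - e', the element splits as q + c d, where q lies in the image for H and d
  -- annihilates that image on both sides. Quasi-inverses of the summands add; c = 0 is covered by
  -- the convention 0⁻¹ = 0.
  have hq : TwistedL1.compCc φ ⊤ f + c • e' ∈ LinearMap.range (TwistedL1.compCc φ H) :=
    Submodule.add_mem _ ⟨⟨f, hfH⟩, rfl⟩ (Submodule.smul_mem _ c heH)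
  obtain ⟨q, hqdef⟩ : ∃ q, q = TwistedL1.compCc φ ⊤ f + c • e' := ⟨_, rfl⟩
  rw [← hqdef] at hq
  obtain ⟨x, hx, hqx⟩ := TwistedL1.regular_range_compCc hφ hH hq
  obtain ⟨d, hd⟩ : ∃ d, d = 1 - e' := ⟨_, rfl⟩
  have hd1 : ∀ a ∈ LinearMap.range (TwistedL1.compCc φ H), d * a = 0 ∧ a * d = 0 := fun a ha => by
    rw [hd, sub_mul, mul_sub, one_mul, mul_one, (hunit' a ha).1, (hunit' a ha).2, sub_self]
    exact ⟨rfl, rfl⟩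
  have hdd : d * d = d := by
    nth_rw 2 [hd]
    rw [mul_sub, mul_one, (hd1 e' heH).1, sub_zero]
  have hr : TwistedL1.compCc φ ⊤ f + algebraMap ℂ R c = q + c • d := by
    rw [hqdef, hd, Algebra.algebraMap_eq_smul_one, smul_sub]
    abel
  refine ⟨x + c⁻¹ • d, ?_, ?_⟩
  · have h1 : x + c⁻¹ • d = (x - c⁻¹ • e') + algebraMap ℂ R c⁻¹ := by
      rw [hd, Algebra.algebraMap_eq_smul_one, smul_sub]
      abel
    obtain ⟨g, hg⟩ := TwistedL1.range_compCc_mono φ (le_top : H ≤ ⊤)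
      (Submodule.sub_mem _ hx (Submodule.smul_mem _ c⁻¹ heH))
    exact ⟨g, c⁻¹, by rw [hg, h1]⟩
  · have h2 : (q + c • d) * (x + c⁻¹ • d) = q * x + (c * c⁻¹) • d := by
      simp only [mul_add, add_mul, mul_smul_comm, smul_mul_assoc, (hd1 q hq).2, (hd1 x hx).1, hdd,
        smul_zero, smul_smul, add_zero, zero_add]
      rw [mul_comm c⁻¹ c]
    rw [hr, h2]
    simp only [mul_add, add_mul, mul_smul_comm, smul_mul_assoc, mul_assoc, (hd1 x hx).2,
      (hd1 q hq).1, hdd, smul_zero, mul_zero, smul_smul, add_zero, zero_add]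
    rw [← mul_assoc, hqx, ← mul_assoc, show c * c * c⁻¹ = c by
      rw [mul_assoc]
      rcases eq_or_ne c 0 with rfl | h
      · simp
      · rw [mul_inv_cancel₀ h, mul_one]]

end Representations

/-! ### The action on the separating space -/

/-- A von Neumann regular ring without strictly decreasing sequences of idempotents is
semisimple. -/
theorem isSemisimpleRing_of_regular_of_idempotents {R : Type*} [Ring R]
    (hreg : ∀ a : R, ∃ x, a * x * a = a)
    (hchain : ∀ e : ℕ → R, (∀ n, IsIdempotentElem (e n)) → (∀ n, e n * e (n + 1) = e (n + 1)) →
      (∀ n, e (n + 1) * e n = e (n + 1)) → ∃ n, e (n + 1) = e n) : IsSemisimpleRing R := by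
  refine isSemisimpleRing_of_regular hreg fun p hp hpp => ?_
  -- e n = p n ⋯ p 0 is an idempotent generating the same right ideal as p n, and the new sequence
  -- decreases on both sides.
  obtain ⟨e, he0, he⟩ : ∃ e : ℕ → R, e 0 = p 0 ∧ ∀ n, e (n + 1) = p (n + 1) * e n :=
    ⟨fun n => Nat.rec (p 0) (fun n s => p (n + 1) * s) n, rfl, fun n => rfl⟩
  have h : ∀ n, e n * p n = p n ∧ e n * e n = e n := by
    intro n
    induction n with
    | zero => rw [he0]; exact ⟨hp 0, hp 0⟩
    | succ n ih =>
      have h1 : e n * p (n + 1) = p (n + 1) := by rw [← hpp, ← mul_assoc, ih.1]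
      have h2 : e (n + 1) * p (n + 1) = p (n + 1) := by rw [he, mul_assoc, h1, (hp _).eq]
      exact ⟨h2, by nth_rw 2 [he]; rw [← mul_assoc, h2, ← he]⟩
  obtain ⟨n, hn⟩ := hchain e (fun n => (h n).2)
    (fun n => by rw [he, ← mul_assoc, ← hpp n, ← mul_assoc, (h n).1, hpp])
    (fun n => by rw [he, mul_assoc, (h n).2])
  refine ⟨n, ?_⟩
  have h1 := (h n).1
  rw [← hn, he, mul_assoc, (h n).1] at h1
  exact h1

/-- A jointly continuous bilinear map as a bounded bilinear map. -/
def LinearMap.toBounded₂ {E F H : Type*} [NormedAddCommGroup E] [NormedSpace ℂ E]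
    [NormedAddCommGroup F] [NormedSpace ℂ F] [NormedAddCommGroup H] [NormedSpace ℂ H]
    (f : E →ₗ[ℂ] F →ₗ[ℂ] H) (hf : Continuous fun p : E × F => f p.1 p.2) : E →L[ℂ] F →L[ℂ] H :=
  have h : ∃ C, ∀ x y, ‖f x y‖ ≤ C * ‖x‖ * ‖y‖ := by
    have h0 := Metric.continuousAt_iff.1 (hf.continuousAt (x := (0, 0))) 1 one_pos
    obtain ⟨δ, hδ, h⟩ := h0
    refine ⟨(δ / 2)⁻¹ * (δ / 2)⁻¹, fun x y => ?_⟩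
    rcases eq_or_ne x 0 with rfl | hx
    · simp
    rcases eq_or_ne y 0 with rfl | hy
    · simp
    have hx' := norm_pos_iff.2 hx
    have hy' := norm_pos_iff.2 hy
    have key : ∀ r : ℝ, 0 < r → ‖((δ / 2 / r : ℝ) : ℂ)‖ = δ / 2 / r := fun r hr => by
      rw [Complex.norm_real, Real.norm_of_nonneg (by positivity)]
    have h1 := @h ((((δ / 2 / ‖x‖ : ℝ) : ℂ) • x), (((δ / 2 / ‖y‖ : ℝ) : ℂ) • y)) (by
      rw [Prod.dist_eq, dist_zero_right, dist_zero_right, norm_smul, norm_smul, key _ hx',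
        key _ hy', div_mul_cancel₀ _ hx'.ne', div_mul_cancel₀ _ hy'.ne', max_self]
      linarith)
    simp only [map_zero, dist_zero_right, map_smul, LinearMap.smul_apply, norm_smul, key _ hx',
      key _ hy'] at h1
    have h2 : ‖f x y‖ = (δ / 2)⁻¹ * (δ / 2)⁻¹ * ‖x‖ * ‖y‖ *
        (δ / 2 / ‖y‖ * (δ / 2 / ‖x‖ * ‖f x y‖)) := by
      field_simp
    rw [h2]
    refine mul_le_of_le_one_right (by positivity) ?_
    linarith
  LinearMap.mkContinuousOfExistsBound₂ f h

section Action

variable {B X₁ X₂ : Type*} [NormedAddCommGroup B] [NormedSpace ℂ B]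
  [NormedAddCommGroup X₁] [NormedSpace ℂ X₁] [NormedAddCommGroup X₂] [NormedSpace ℂ X₂]
  (θ : X₁ →ₗ[ℂ] X₂) (Φ₁ : B →L[ℂ] X₁ →L[ℂ] X₁) (Φ₂ : B →L[ℂ] X₂ →L[ℂ] X₂)

/-- The operators on the separating space of `θ` that are induced by operators that intertwine `θ`
up to continuous operators. -/
def separatingAction (h : ∀ b, Continuous fun ξ => θ (Φ₁ b ξ) - Φ₂ b (θ ξ)) :
    B →L[ℂ] separatingSubmodule θ →L[ℂ] separatingSubmodule θ :=
  LinearMap.mkContinuous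
    { toFun := fun b => (Φ₂ b ∘L (separatingSubmodule θ).subtypeL).codRestrict _
        fun η => map_mem_separatingSpace (Φ₁ b) (Φ₂ b) (h b) η.2
      map_add' := fun a b => by ext η; simp; rfl
      map_smul' := fun c b => by ext η; simp; rfl } ‖Φ₂‖ fun b =>
    ContinuousLinearMap.opNorm_le_bound _ (by positivity) fun η => Φ₂.le_opNorm₂ b η

/-- The operators on the separating space contain no strictly decreasing sequences of
idempotents. -/
theorem exists_separatingAction_stable [CompleteSpace X₁] [CompleteSpace X₂]
    (h : ∀ b, Continuous fun ξ => θ (Φ₁ b ξ) - Φ₂ b (θ ξ))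
    (e : ℕ → separatingSubmodule θ →L[ℂ] separatingSubmodule θ)
    (he : ∀ n, ∃ (b : B) (c : ℂ), e n = separatingAction θ Φ₁ Φ₂ h b + c • 1)
    (hidem : ∀ n, IsIdempotentElem (e n)) (hl : ∀ n, e n * e (n + 1) = e (n + 1))
    (hr : ∀ n, e (n + 1) * e n = e (n + 1)) :
    ∃ n, e (n + 1) = e n := by
  choose b c hbc using he
  have he' : ∀ n (η : separatingSubmodule θ),
      ((e n η : separatingSubmodule θ) : X₂) = (Φ₂ (b n) + c n • (1 : X₂ →L[ℂ] X₂)) η := fun n η => by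
    rw [hbc]; rfl
  -- The n-th factor uses index n + 1, so P (n + 1) acts on S(θ) as e 1 ⋯ e (n + 1) = e (n + 1),
  -- while P 0 is the identity rather than e 0.
  obtain ⟨P, hP0, hP⟩ : ∃ P : ℕ → X₂ →L[ℂ] X₂, P 0 = 1 ∧
      ∀ n, P (n + 1) = P n * (Φ₂ (b (n + 1)) + c (n + 1) • (1 : X₂ →L[ℂ] X₂)) :=
    ⟨fun n => Nat.rec 1 (fun n s => s * (Φ₂ (b (n + 1)) + c (n + 1) • (1 : X₂ →L[ℂ] X₂))) n, rfl, fun n => rfl⟩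
  have hPe : ∀ n (η : separatingSubmodule θ), P (n + 1) η = e (n + 1) η := by
    intro n
    induction n with
    | zero => intro η; rw [hP, hP0, one_mul, he']
    | succ n ih =>
      intro η
      rw [hP, mul_apply_eq_comp, ← he', ih, ← mul_apply_eq_comp, hl]
  obtain ⟨n, hn⟩ := exists_separatingSpace_stable θ
    (fun n => Φ₁ (b (n + 1)) + c (n + 1) • (1 : X₁ →L[ℂ] X₁))
    (fun n => Φ₂ (b (n + 1)) + c (n + 1) • (1 : X₂ →L[ℂ] X₂)) P
    (fun n => (h (b (n + 1))).congr fun ξ => by simp) hP0 hP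
  have hfix : ∀ x ∈ closure (P (n + 1) '' separatingSpace θ),
      (Φ₂ (b (n + 1)) + c (n + 1) • (1 : X₂ →L[ℂ] X₂)) x = x := by
    intro x hx
    refine closure_minimal ?_ (isClosed_eq (ContinuousLinearMap.continuous _) continuous_id) hx
    rintro _ ⟨η, hη, rfl⟩
    have h1 := hPe n ⟨η, hη⟩
    change P (n + 1) η = _ at h1
    change (Φ₂ (b (n + 1)) + c (n + 1) • (1 : X₂ →L[ℂ] X₂)) (P (n + 1) η) = P (n + 1) η
    rw [h1, ← he', ← mul_apply_eq_comp, (hidem _).eq]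
  -- Since P 0 = 1, stabilisation at 0 says that e 1 fixes all of S(θ), whence e 1 = 1 = e 0. Later,
  -- e (n + 2) fixes the range of e (n + 1), and `hr` gives equality.
  rcases n with _ | n
  · refine ⟨0, ?_⟩
    have h1 : e 1 = 1 := by
      ext η
      rw [he']
      exact hfix _ (by simpa [hP0] using hn η η.2)
    have h2 := hl 0
    rw [zero_add, h1, mul_one] at h2
    rw [zero_add, h1, h2]
  · refine ⟨n + 1, ?_⟩
    rw [← hr (n + 1)]
    ext η
    rw [mul_apply_eq_comp, he']
    have h1 := hfix _ (hn η η.2)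
    rwa [hPe n η] at h1

end Action

theorem FiniteDimensional.map_of_quotient_submoduleOf {V W : Type*} [AddCommGroup V] [Module ℂ V]
    [AddCommGroup W] [Module ℂ W] (f : V →ₗ[ℂ] W) {K N : Submodule ℂ V}
    (hK : K ≤ LinearMap.ker f) (h : FiniteDimensional ℂ (N ⧸ K.submoduleOf N)) :
    FiniteDimensional ℂ (N.map f) := by
  have h1 : K.submoduleOf N ≤ LinearMap.ker (f.domRestrict N) := fun x hx => hK hx
  have h2 : LinearMap.range ((K.submoduleOf N).liftQ (f.domRestrict N) h1) = N.map f := by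
    rw [Submodule.range_liftQ, LinearMap.range_domRestrict]
  rw [← h2]
  infer_instance

theorem FiniteDimensional.quotient_ker_inf_ker {V W W' : Type*} [AddCommGroup V] [Module ℂ V]
    [AddCommGroup W] [Module ℂ W] [AddCommGroup W'] [Module ℂ W'] {f : V →ₗ[ℂ] W}
    {g : V →ₗ[ℂ] W'} (hf : FiniteDimensional ℂ (LinearMap.range f))
    (hg : FiniteDimensional ℂ (LinearMap.range g)) :
    FiniteDimensional ℂ (V ⧸ LinearMap.ker f ⊓ LinearMap.ker g) := by
  have h : LinearMap.ker f ⊓ LinearMap.ker g =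
      LinearMap.ker (f.rangeRestrict.prod g.rangeRestrict) := by
    rw [LinearMap.ker_prod, LinearMap.ker_rangeRestrict, LinearMap.ker_rangeRestrict]
  rw [h]
  exact Module.Finite.equiv (f.rangeRestrict.prod g.rangeRestrict).quotKerEquivRange.symm

/-! ### Finite-dimensionality of the image of a representation -/

section Range

variable {G : Type*} [Group G] [TopologicalSpace G] [IsTopologicalGroup G]
  [LocallyCompactSpace G] [T2Space G] [MeasurableSpace G] [BorelSpace G]
  {μ : Measure G} [μ.IsHaarMeasure] [μ.Regular]
  {A : Type*} [NonUnitalCStarAlgebra A] {T : TwistedAction G A}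
  {R : Type*} [NormedRing R] [NormedAlgebra ℂ R] {φ : TwistedL1 T μ →L[ℂ] R}

/-- A representation that has finite-dimensional image on the convolution algebras of the open
compactly generated subgroups and whose image has no strictly decreasing sequences of idempotents
has finite-dimensional image. -/
theorem TwistedL1.finiteDimensional_range (hφ : ∀ a b, φ (a * b) = φ a * φ b)
    (hfin : ∀ H : Subgroup G, IsOpen (H : Set G) → H.IsCompactlyGenerated →
      FiniteDimensional ℂ ((TwistedL1.ofSubgroup T μ H).map (φ : TwistedL1 T μ →ₗ[ℂ] R)))
    (hchain : ∀ e : ℕ → R, (∀ n, ∃ (b : TwistedL1 T μ) (c : ℂ), e n = φ b + c • 1) →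
      (∀ n, IsIdempotentElem (e n)) → (∀ n, e n * e (n + 1) = e (n + 1)) → (∀ n, e (n + 1) * e n = e (n + 1)) →
      ∃ n, e (n + 1) = e n) :
    FiniteDimensional ℂ (LinearMap.range (φ : TwistedL1 T μ →ₗ[ℂ] R)) := by
  have hreg := TwistedL1.regular_unitalRange hφ hfin
  have hss : IsSemisimpleRing (TwistedL1.unitalRange hφ ⊤) := by
    refine isSemisimpleRing_of_regular_of_idempotents (fun a => ?_) fun e h0 h1 h2 => ?_
    · obtain ⟨x, hx, h⟩ := (hreg a a.2).2
      exact ⟨⟨x, hx⟩, Subtype.ext h⟩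
    · have he : ∀ n, ∃ (b : TwistedL1 T μ) (c : ℂ), (e n : R) = φ b + c • 1 := fun n => by
        obtain ⟨f, c, h⟩ := (e n).2
        exact ⟨TwistedL1.ofCc T μ ⊤ f, c, by rw [h, Algebra.algebraMap_eq_smul_one]; rfl⟩
      obtain ⟨n, hn⟩ := hchain (fun n => e n) he (fun n => congrArg Subtype.val (h0 n))
        (fun n => congrArg Subtype.val (h1 n)) (fun n => congrArg Subtype.val (h2 n))
      exact ⟨n, Subtype.ext hn⟩
  have hfd : Module.Finite ℂ (TwistedL1.unitalRange hφ ⊤) :=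
    finite_of_isSemisimpleRing_of_isIntegral fun a =>
      (isIntegral_algHom_iff (TwistedL1.unitalRange hφ ⊤).val Subtype.val_injective).1
        (hreg a a.2).1
  have hfd' : FiniteDimensional ℂ (Subalgebra.toSubmodule (TwistedL1.unitalRange hφ ⊤)) := hfd
  -- Being finite-dimensional, the algebra is closed, so density of the compactly supported
  -- functions brings in the image of all of L¹.
  have hcl := (Subalgebra.toSubmodule (TwistedL1.unitalRange hφ ⊤)).closed_of_finiteDimensional
  refine Submodule.finiteDimensional_of_le
    (S₂ := Subalgebra.toSubmodule (TwistedL1.unitalRange hφ ⊤)) ?_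
  rintro _ ⟨b, rfl⟩
  refine (TwistedL1.dense_range_ofCc T μ).induction_on
    (p := fun b => φ b ∈ Subalgebra.toSubmodule (TwistedL1.unitalRange hφ ⊤)) b
    (hcl.preimage φ.continuous) fun f => ⟨f, 0, ?_⟩
  rw [map_zero, add_zero]
  rfl

end Range

/-! ### The left and right actions on the separating space -/

section RangeAction

variable {G : Type*} [Group G] [TopologicalSpace G] [IsTopologicalGroup G]
  [LocallyCompactSpace G] [T2Space G] [MeasurableSpace G] [BorelSpace G]
  {μ : Measure G} [μ.IsHaarMeasure] [μ.Regular]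
  {A : Type*} [NonUnitalCStarAlgebra A] {T : TwistedAction G A}
  {X₁ : Type*} [NormedAddCommGroup X₁] [NormedSpace ℂ X₁] [CompleteSpace X₁]
  {X₂ : Type*} [NormedAddCommGroup X₂] [NormedSpace ℂ X₂] [CompleteSpace X₂]
  (θ : X₁ →ₗ[ℂ] X₂) (Φ₁ : TwistedL1 T μ →L[ℂ] X₁ →L[ℂ] X₁)
  (Φ₂ : TwistedL1 T μ →L[ℂ] X₂ →L[ℂ] X₂) (h : ∀ b, Continuous fun ξ => θ (Φ₁ b ξ) - Φ₂ b (θ ξ))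
  {K : Submodule ℂ (TwistedL1 T μ)}

/-- If `Φ₂` is multiplicative and the induced action on the separating space vanishes on a subspace
of finite codimension in the convolution algebras of the open compactly generated subgroups, then
the image of the induced action is finite-dimensional. -/
theorem finiteDimensional_range_separatingAction_of_mul
    (hmul : ∀ a b η, Φ₂ (a * b) η = Φ₂ a (Φ₂ b η))
    (hK : K ≤ LinearMap.ker (separatingAction θ Φ₁ Φ₂ h).toLinearMap)
    (hfin : ∀ H : Subgroup G, IsOpen (H : Set G) → H.IsCompactlyGenerated →
      FiniteDimensional ℂ (TwistedL1.ofSubgroup T μ H ⧸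
        K.submoduleOf (TwistedL1.ofSubgroup T μ H))) :
    FiniteDimensional ℂ (LinearMap.range (separatingAction θ Φ₁ Φ₂ h).toLinearMap) := by
  have h1 := TwistedL1.finiteDimensional_range
    (R := separatingSubmodule θ →L[ℂ] separatingSubmodule θ) (φ := separatingAction θ Φ₁ Φ₂ h)
  have h2 : ∀ H : Subgroup G, IsOpen (H : Set G) → H.IsCompactlyGenerated → FiniteDimensional ℂ
      ((TwistedL1.ofSubgroup T μ H).map (separatingAction θ Φ₁ Φ₂ h).toLinearMap) := fun H hH hH' =>
    FiniteDimensional.map_of_quotient_submoduleOf _ hK (hfin H hH hH')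
  have h3 := h1 (fun a b => by ext η; exact hmul a b η) h2
  have h4 := h3 (exists_separatingAction_stable θ Φ₁ Φ₂ h)
  exact h4

/-- If `Φ₂` reverses products and the induced action on the separating space vanishes on a subspace
of finite codimension in the convolution algebras of the open compactly generated subgroups, then
the image of the induced action is finite-dimensional. -/
theorem finiteDimensional_range_separatingAction_of_mul_reverse
    (hmul : ∀ a b η, Φ₂ (a * b) η = Φ₂ b (Φ₂ a η))
    (hK : K ≤ LinearMap.ker (separatingAction θ Φ₁ Φ₂ h).toLinearMap)
    (hfin : ∀ H : Subgroup G, IsOpen (H : Set G) → H.IsCompactlyGenerated →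
      FiniteDimensional ℂ (TwistedL1.ofSubgroup T μ H ⧸
        K.submoduleOf (TwistedL1.ofSubgroup T μ H))) :
    FiniteDimensional ℂ (LinearMap.range (separatingAction θ Φ₁ Φ₂ h).toLinearMap) := by
  let o : (separatingSubmodule θ →L[ℂ] separatingSubmodule θ) ≃L[ℂ]
      (separatingSubmodule θ →L[ℂ] separatingSubmodule θ)ᵐᵒᵖ :=
    MulOpposite.opContinuousLinearEquiv ℂ
  let φ : TwistedL1 T μ →L[ℂ] (separatingSubmodule θ →L[ℂ] separatingSubmodule θ)ᵐᵒᵖ :=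
    o.toContinuousLinearMap ∘L separatingAction θ Φ₁ Φ₂ h
  have hmul' : ∀ a b, separatingAction θ Φ₁ Φ₂ h (a * b) =
      separatingAction θ Φ₁ Φ₂ h b * separatingAction θ Φ₁ Φ₂ h a := fun a b => by
    ext η
    exact hmul a b η
  have hK' : K ≤ LinearMap.ker φ.toLinearMap := fun b hb => congrArg MulOpposite.op (hK hb)
  have h1 := TwistedL1.finiteDimensional_range
    (R := (separatingSubmodule θ →L[ℂ] separatingSubmodule θ)ᵐᵒᵖ) (φ := φ)
  have h2 : ∀ H : Subgroup G, IsOpen (H : Set G) → H.IsCompactlyGenerated → FiniteDimensional ℂ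
      ((TwistedL1.ofSubgroup T μ H).map φ.toLinearMap) := fun H hH hH' =>
    FiniteDimensional.map_of_quotient_submoduleOf _ hK' (hfin H hH hH')
  have h3 := h1 (fun a b => congrArg MulOpposite.op (hmul' a b)) h2
  -- Passing to the opposite algebra interchanges the two conditions on a decreasing sequence of
  -- idempotents, so `h1` and `h2` trade places.
  have h4 := h3 (fun e he h0 h1 h2 => by
      obtain ⟨n, hn⟩ := exists_separatingAction_stable θ Φ₁ Φ₂ h (fun n => (e n).unop)
        (fun n => by
          obtain ⟨b, c, h⟩ := he n
          exact ⟨b, c, congrArg MulOpposite.unop h⟩)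
        (fun n => congrArg MulOpposite.unop (h0 n)) (fun n => congrArg MulOpposite.unop (h2 n))
        fun n => congrArg MulOpposite.unop (h1 n)
      exact ⟨n, MulOpposite.unop_injective hn⟩)
  have h5 : LinearMap.range φ.toLinearMap =
      (LinearMap.range (separatingAction θ Φ₁ Φ₂ h).toLinearMap).map o.toLinearMap :=
    LinearMap.range_comp _ _
  rw [h5] at h4
  exact Module.Finite.equiv (o.toLinearEquiv.submoduleMap _).symm

end RangeAction

/-- Let `θ` be an intertwining operator between Banach bimodules over the twisted convolution
algebra of a locally compact group. If the continuity ideal of `θ` has finite codimension in the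
convolution algebras of all open compactly generated subgroups, then it has finite codimension. -/
theorem mainTheorem2
    {G : Type*} [Group G] [TopologicalSpace G] [IsTopologicalGroup G]
    [LocallyCompactSpace G] [T2Space G] [MeasurableSpace G] [BorelSpace G]
    (μ : Measure G) [μ.IsHaarMeasure] [μ.Regular]
    {A : Type*} [NonUnitalCStarAlgebra A] (T : TwistedAction G A)
    {X₁ : Type*} [NormedAddCommGroup X₁] [NormedSpace ℂ X₁] [CompleteSpace X₁]
    {X₂ : Type*} [NormedAddCommGroup X₂] [NormedSpace ℂ X₂] [CompleteSpace X₂]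
    (M₁ : BanachBimodule (TwistedL1 T μ) X₁) (M₂ : BanachBimodule (TwistedL1 T μ) X₂)
    (θ : X₁ →ₗ[ℂ] X₂) (hθ : IsIntertwining M₁ M₂ θ)
    (hfin : ∀ H : Subgroup G, IsOpen (H : Set G) → H.IsCompactlyGenerated →
      FiniteDimensional ℂ (TwistedL1.ofSubgroup T μ H ⧸
        (continuityIdeal M₂ θ).submoduleOf (TwistedL1.ofSubgroup T μ H))) :
    FiniteDimensional ℂ (TwistedL1 T μ ⧸ continuityIdeal M₂ θ) := by
  have hl : ∀ b, Continuous fun ξ => θ (M₁.left.toBounded₂ M₁.continuous_left b ξ) -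
      M₂.left.toBounded₂ M₂.continuous_left b (θ ξ) := fun b => (hθ b).1
  have hr : ∀ b, Continuous fun ξ =>
      θ (M₁.right.toBounded₂ (M₁.continuous_right.comp continuous_swap) b ξ) -
      M₂.right.toBounded₂ (M₂.continuous_right.comp continuous_swap) b (θ ξ) := fun b => (hθ b).2
  have hmem : continuityIdeal M₂ θ =
      LinearMap.ker (separatingAction θ _ (M₂.left.toBounded₂ M₂.continuous_left) hl).toLinearMap ⊓
      LinearMap.ker (separatingAction θ _
        (M₂.right.toBounded₂ (M₂.continuous_right.comp continuous_swap)) hr).toLinearMap := by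
    ext b
    constructor
    · intro h
      refine ⟨LinearMap.mem_ker.2 ?_, LinearMap.mem_ker.2 ?_⟩
      · ext η
        exact (h η η.2).1
      · ext η
        exact (h η η.2).2
    · rintro ⟨h1, h2⟩ η hη
      have h3 := DFunLike.congr_fun (LinearMap.mem_ker.1 h1) (⟨η, hη⟩ : separatingSubmodule θ)
      have h4 := DFunLike.congr_fun (LinearMap.mem_ker.1 h2) (⟨η, hη⟩ : separatingSubmodule θ)
      exact ⟨congrArg Subtype.val h3, congrArg Subtype.val h4⟩
  have h1 := finiteDimensional_range_separatingAction_of_mul θ _ _ hl M₂.left_mul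
    (hmem.le.trans inf_le_left) hfin
  have h2 := finiteDimensional_range_separatingAction_of_mul_reverse θ _ _ hr M₂.right_mul
    (hmem.le.trans inf_le_right) hfin
  rw [hmem]
  exact FiniteDimensional.quotient_ker_inf_ker h1 h2

end
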